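/- Identify the Heisenberg group with $\mathbb R^3$ through exponential coordinates, with group law $(x,y,z)\cdot(x',y',z')=\bigl(x+x',\,y+y',\,z+z'+\tfrac12(xy'-yx')\bigr)$. Let $(X_t,Y_t)_{t\ge0}$ be a standard Brownian motion on $\mathbb R^2$ started from the origin, let $A_t=\tfrac12\bigl(\int_0^t X_s\,dY_s-\int_0^t Y_s\,dX_s\bigr)$ be its Lévy area (Itô integrals), and let $\gamma$ be the law on $\mathbb R^3$ of $(X_1,Y_1,A_1)$, i.e. the law at time $1$ of the sub-elliptic heat process on the Heisenberg group started from the origin (the diffusion with generator $\tfrac12(\mathsf X^2+\mathsf Y^2)$, where $\mathsf X=\partial_x-\tfrac y2\partial_z$ and $\mathsf Y=\partial_y+\tfrac x2\partial_z$). For $g\ge0$ write $\mathrm{Ent}_\gamma(g)=\mathbf E_\gamma[g\log g]-\mathbf E_\gamma[g]\log\mathbf E_\gamma[g]$, with $0\log0=0$. Then for every real number $\nu>0$ and every Schwartz function $f:\mathbb R^3\to\mathbb R$, $$ \mathrm{Ent}_\gamma(f^2)\;\le\;2\nu\bigl(e^{1/\nu}-1\bigr)\, \mathbf E_\gamma\Bigl[(\partial_xf)^2+(\partial_yf)^2+\Bigl(\nu+\frac{x^2+y^2}{4}\Bigr)(\partial_zf)^2\Bigr].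 $$ -/

import Mathlib

open MeasureTheory ProbabilityTheory Filter
open scoped NNReal SchwartzMap

/-- The Heisenberg group in exponential coordinates `(x, y, z)`, identified with `ℝ³`
(with its usual topology, Borel sets and differentiable structure). -/
abbrev HeisenbergSpace : Type := ℝ × ℝ × ℝ

/-- The group law
`(x, y, z) · (x', y', z') = (x + x', y + y', z + z' + (x y' - y x') / 2)`. -/
noncomputable def heisenbergMul (h g : HeisenbergSpace) : HeisenbergSpace :=
  (h.1 + g.1, h.2.1 + g.2.1, h.2.2 + g.2.2 + (1 / 2) * (h.1 * g.2.1 - h.2.1 * g.1))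

/-- The random variable `I` is (a version of) the Itô integral `∫₀ᵗ U dB`: it is the limit in
probability of the nonanticipating Riemann sums `∑ U(kt/n) (B((k+1)t/n) - B(kt/n))`, `k < n`.
It is used here for integrands `U` that are adapted with almost surely continuous paths. -/
def IsItoIntegral {Ω : Type*} [MeasurableSpace Ω] (P : Measure Ω)
    (U B : ℝ≥0 → Ω → ℝ) (t : ℝ≥0) (I : Ω → ℝ) : Prop :=
  TendstoInMeasure P
    (fun (n : ℕ) (ω : Ω) => ∑ k ∈ Finset.range n,
      U ((k : ℝ≥0) * t / (n : ℝ≥0)) ω *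
        (B (((k : ℝ≥0) + 1) * t / (n : ℝ≥0)) ω - B ((k : ℝ≥0) * t / (n : ℝ≥0)) ω))
    atTop I

/-- `A` is a continuous version of the Lévy area
`A_t = (∫₀ᵗ X dY - ∫₀ᵗ Y dX) / 2` of the planar process `(X, Y)`. -/
def IsLevyArea {Ω : Type*} [MeasurableSpace Ω] (P : Measure Ω)
    (X Y A : ℝ≥0 → Ω → ℝ) : Prop :=
  (∀ᵐ ω ∂P, Continuous fun t => A t ω) ∧
  ∀ t : ℝ≥0, ∃ I J : Ω → ℝ, IsItoIntegral P X Y t I ∧ IsItoIntegral P Y X t J ∧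
    A t =ᵐ[P] fun ω => (1 / 2) * (I ω - J ω)

/-- `H` is a sub-elliptic (`β = 0`) heat process on the Heisenberg group started from `h`:
`H_t = h · (X_t, Y_t, A_t)` where `(X, Y)` is a standard planar Brownian motion started from the
origin (two independent standard real Brownian motions) and `A` is its Lévy area. -/
def IsHeisenbergHeatProcess {Ω : Type*} [MeasurableSpace Ω] (P : Measure Ω)
    (h : HeisenbergSpace) (H : ℝ≥0 → Ω → HeisenbergSpace) : Prop :=
  ∃ X Y A : ℝ≥0 → Ω → ℝ,
    IsBrownianReal X P ∧ IsBrownianReal Y P ∧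
    IndepFun (fun ω t => X t ω) (fun ω t => Y t ω) P ∧
    IsLevyArea P X Y A ∧
    ∀ t ω, H t ω = heisenbergMul h (X t ω, Y t ω, A t ω)

/-- The entropy `Ent_μ(g) = E_μ[Φ(g)] - Φ(E_μ[g])` with `Φ(u) = u log u`. -/
noncomputable def entropy {α : Type*} [MeasurableSpace α] (μ : Measure α) (g : α → ℝ) : ℝ :=
  (∫ p, g p * Real.log (g p) ∂μ) - (∫ p, g p ∂μ) * Real.log (∫ p, g p ∂μ)

/-- The coordinate partial derivative `∂ₓ f`. -/
noncomputable def partialX (f : HeisenbergSpace → ℝ) (p : HeisenbergSpace) : ℝ :=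
  fderiv ℝ f p (1, 0, 0)

/-- The coordinate partial derivative `∂_y f`. -/
noncomputable def partialY (f : HeisenbergSpace → ℝ) (p : HeisenbergSpace) : ℝ :=
  fderiv ℝ f p (0, 1, 0)

/-- The coordinate partial derivative `∂_z f`. -/
noncomputable def partialZ (f : HeisenbergSpace → ℝ) (p : HeisenbergSpace) : ℝ :=
  fderiv ℝ f p (0, 0, 1)

/-! Write X, Y, Z for the left-invariant fields, with [X, Y] = Z, and Γ(f) = (Xf)² + (Yf)² + ν(Zf)²
(`leftEnergy`). For the heat semigroup (P_s) and g > 0, the s-derivative of P_s(u log u), with u =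
P_{1-s} g, is half of P_s applied to ((Xu)² + (Yu)²)/u, hence at most half of P_s(Γ(u)/u). The
commutator is paid for by the term νZ²: Γ(P_s g)/P_s g ≤ e^{s/ν} P_s(Γ(g)/g). Integrating e^{s/ν}/2
over [0, 1] gives Ent(g) ≤ (ν/2)(e^{1/ν} - 1) E[Γ(g)/g], and g = f² has Γ(g)/g = 4Γ(f).

The semigroup is replaced by a random walk with horizontal Gaussian steps of variance t² = 1/(n+1),
so that no regularity of heat kernels is needed. One step costs a factor 1 + t²/ν in the gradient
bound (`gradient_step_plane`) and adds t²/2 times the energy to the entropy (`entropy_step_plane`),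
each up to O(t³). Over t⁻² steps the errors add up to O(t), and the geometric series of the factors
replaces the integral (`entropy_walkLaw_le`).

The gradient bound rests on rotational invariance of the step: the infinitesimal rotation about the
base point integrates to zero (`integral_rotation`). Adding the right multiple of this identity
before applying Young's inequality cancels the first-order cross terms, which would otherwise spoil
the constant.

Sampled at multiples of 1/(n+1), Brownian motion with its Riemann-sum area is exactly this walk, and
the Riemann sums converge to the Lévy area (`IsHeisenbergHeatProcess.exists_isWalkLimit`). The limit
is the inequality for Γ. Finally γ is invariant under the inversion p ↦ -p, which exchanges left-
and right-invariant fields. Averaging the inequalities for f and f(-·) removes the cross terms in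
(∂ₓf ∓ (y/2)∂_zf)² and (∂_yf ± (x/2)∂_zf)², and leaves the stated energy. -/

/-! ### Functions of polynomial growth with respect to a weight -/

/-- `φ` is measurable and bounded by a multiple of a power of the weight `W`. -/
def Tame {α : Type*} [MeasurableSpace α] (W φ : α → ℝ) : Prop :=
  Measurable φ ∧ ∃ (C : ℝ) (m : ℕ), 0 ≤ C ∧ ∀ x, |φ x| ≤ C * W x ^ m

namespace Tame

variable {α : Type*} [MeasurableSpace α] {W φ ψ : α → ℝ}

lemma of_bounded (hφ : Measurable φ) {C : ℝ} (h : ∀ x, |φ x| ≤ C) : Tame W φ :=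
  ⟨hφ, |C|, 0, abs_nonneg _, fun x => by simpa using (h x).trans (le_abs_self C)⟩

lemma const (c : ℝ) : Tame W fun _ => c := of_bounded measurable_const fun _ => le_rfl

lemma add (h1 : ∀ x, 1 ≤ W x) (hφ : Tame W φ) (hψ : Tame W ψ) : Tame W fun x => φ x + ψ x := by
  obtain ⟨hφm, C, m, hC, hφ⟩ := hφ
  obtain ⟨hψm, D, k, hD, hψ⟩ := hψ
  refine ⟨hφm.add hψm, C + D, max m k, add_nonneg hC hD, fun x => ?_⟩
  have h2 : W x ^ m ≤ W x ^ max m k := pow_le_pow_right₀ (h1 x) (le_max_left _ _)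
  have h3 : W x ^ k ≤ W x ^ max m k := pow_le_pow_right₀ (h1 x) (le_max_right _ _)
  calc |φ x + ψ x| ≤ |φ x| + |ψ x| := abs_add_le _ _
    _ ≤ C * W x ^ m + D * W x ^ k := add_le_add (hφ x) (hψ x)
    _ ≤ C * W x ^ max m k + D * W x ^ max m k := by gcongr
    _ = _ := by ring

lemma mul (hφ : Tame W φ) (hψ : Tame W ψ) : Tame W fun x => φ x * ψ x := by
  obtain ⟨hφm, C, m, hC, hφ⟩ := hφ
  obtain ⟨hψm, D, k, hD, hψ⟩ := hψ
  refine ⟨hφm.mul hψm, C * D, m + k, mul_nonneg hC hD, fun x => ?_⟩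
  calc |φ x * ψ x| = |φ x| * |ψ x| := abs_mul _ _
    _ ≤ (C * W x ^ m) * (D * W x ^ k) :=
      mul_le_mul (hφ x) (hψ x) (abs_nonneg _) ((abs_nonneg _).trans (hφ x))
    _ = _ := by ring

lemma const_mul (c : ℝ) (hφ : Tame W φ) : Tame W fun x => c * φ x := (const c).mul hφ

lemma neg (hφ : Tame W φ) : Tame W fun x => -φ x := by
  simpa using hφ.const_mul (-1)

lemma sub (h1 : ∀ x, 1 ≤ W x) (hφ : Tame W φ) (hψ : Tame W ψ) : Tame W fun x => φ x - ψ x := by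
  simpa [sub_eq_add_neg] using hφ.add h1 hψ.neg

lemma pow (hφ : Tame W φ) (k : ℕ) : Tame W fun x => φ x ^ k := by
  induction k with
  | zero => simpa using const 1
  | succ k ih => simpa [pow_succ] using ih.mul hφ

lemma integrable {μ : Measure α} (hW : ∀ m : ℕ, Integrable (fun x => W x ^ m) μ)
    (hφ : Tame W φ) : Integrable φ μ := by
  obtain ⟨hφm, C, m, hC, hφ⟩ := hφ
  exact ((hW m).const_mul C).mono' hφm.aestronglyMeasurable (ae_of_all _ hφ)

end Tame

/-! ### Gaussian moments and the horizontal random walk -/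

/-- The standard Gaussian measure on the plane. -/
noncomputable def planeGaussian : Measure (ℝ × ℝ) := (gaussianReal 0 1).prod (gaussianReal 0 1)

instance : IsProbabilityMeasure planeGaussian := by unfold planeGaussian; infer_instance

/-- The weight `1 + u² + v²` on the plane. -/
def planeWeight (q : ℝ × ℝ) : ℝ := 1 + q.1 ^ 2 + q.2 ^ 2

/-- The weight `1 + x² + y²` on the Heisenberg group. -/
def heisenbergWeight (p : HeisenbergSpace) : ℝ := 1 + p.1 ^ 2 + p.2.1 ^ 2

lemma one_le_planeWeight (q : ℝ × ℝ) : 1 ≤ planeWeight q := by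
  unfold planeWeight; nlinarith [sq_nonneg q.1, sq_nonneg q.2]

lemma one_le_heisenbergWeight (p : HeisenbergSpace) : 1 ≤ heisenbergWeight p := by
  unfold heisenbergWeight; nlinarith [sq_nonneg p.1, sq_nonneg p.2.1]

@[fun_prop]
lemma measurable_planeWeight : Measurable planeWeight := by unfold planeWeight; fun_prop

@[fun_prop]
lemma measurable_heisenbergWeight : Measurable heisenbergWeight := by
  unfold heisenbergWeight; fun_prop

@[fun_prop]
lemma continuous_heisenbergMul :
    Continuous fun z : HeisenbergSpace × HeisenbergSpace => heisenbergMul z.1 z.2 := by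
  unfold heisenbergMul; fun_prop

@[fun_prop]
lemma Measurable.heisenbergMul {α : Type*} [MeasurableSpace α] {f g : α → HeisenbergSpace}
    (hf : Measurable f) (hg : Measurable g) : Measurable fun x => heisenbergMul (f x) (g x) :=
  continuous_heisenbergMul.measurable.comp (hf.prodMk hg)

/-- The horizontal element `(t u, t v, 0)`. -/
def horizontal (t : ℝ) (q : ℝ × ℝ) : HeisenbergSpace := (t * q.1, t * q.2, 0)

@[fun_prop]
lemma continuous_horizontal (t : ℝ) : Continuous (horizontal t) := by
  unfold horizontal; fun_prop

@[fun_prop]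
lemma measurable_horizontal (t : ℝ) : Measurable (horizontal t) :=
  (continuous_horizontal t).measurable

lemma heisenbergMul_assoc (p q r : HeisenbergSpace) :
    heisenbergMul (heisenbergMul p q) r = heisenbergMul p (heisenbergMul q r) := by
  simp only [heisenbergMul, Prod.mk.injEq]
  refine ⟨by ring, by ring, by ring⟩

lemma heisenbergMul_zero (p : HeisenbergSpace) : heisenbergMul p 0 = p := by
  simp [heisenbergMul]

lemma zero_heisenbergMul (p : HeisenbergSpace) : heisenbergMul 0 p = p := by
  simp [heisenbergMul]

lemma neg_heisenbergMul (p q : HeisenbergSpace) :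
    -heisenbergMul p q = heisenbergMul (-q) (-p) := by
  simp only [heisenbergMul, Prod.neg_mk, Prod.fst_neg, Prod.snd_neg, Prod.mk.injEq]
  refine ⟨by ring, by ring, by ring⟩

/-- The weight ignores z because horizontal coordinates simply add under the group law, and
left-invariant derivatives have coefficients growing only in x and y. Moments of the area are
therefore never needed. -/
lemma heisenbergWeight_mul_le (p q : HeisenbergSpace) :
    heisenbergWeight (heisenbergMul p q) ≤ 2 * heisenbergWeight p * heisenbergWeight q := by
  simp only [heisenbergWeight, heisenbergMul]
  nlinarith [sq_nonneg (p.1 - q.1), sq_nonneg (p.2.1 - q.2.1), sq_nonneg (p.1 * q.1),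
    sq_nonneg (p.1 * q.2.1), sq_nonneg (p.2.1 * q.1), sq_nonneg (p.2.1 * q.2.1)]

lemma heisenbergWeight_horizontal_le {t : ℝ} (ht : t ^ 2 ≤ 1) (q : ℝ × ℝ) :
    heisenbergWeight (horizontal t q) ≤ planeWeight q := by
  simp only [heisenbergWeight, horizontal, planeWeight, mul_pow]
  nlinarith [mul_le_mul_of_nonneg_right ht (sq_nonneg q.1),
    mul_le_mul_of_nonneg_right ht (sq_nonneg q.2)]

lemma heisenbergWeight_mul_horizontal_le {t : ℝ} (ht : t ^ 2 ≤ 1) (p : HeisenbergSpace)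
    (q : ℝ × ℝ) : heisenbergWeight (heisenbergMul p (horizontal t q)) ≤
      2 * heisenbergWeight p * planeWeight q :=
  (heisenbergWeight_mul_le p _).trans (mul_le_mul_of_nonneg_left
    (heisenbergWeight_horizontal_le ht q) (by linarith [one_le_heisenbergWeight p]))

/-- The law of the `k`-th position of the random walk on the Heisenberg group whose steps are
horizontal, with Gaussian coordinates of variance `t²`. -/
noncomputable def walkLaw (t : ℝ) : ℕ → Measure HeisenbergSpace
  | 0 => Measure.dirac 0
  | k + 1 => (planeGaussian.prod (walkLaw t k)).map
      fun z => heisenbergMul (horizontal t z.1) z.2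

instance isProbabilityMeasure_walkLaw (t : ℝ) (k : ℕ) : IsProbabilityMeasure (walkLaw t k) := by
  induction k with
  | zero => unfold walkLaw; infer_instance
  | succ k ih => unfold walkLaw; exact Measure.isProbabilityMeasure_map (by fun_prop)

lemma lintegral_walkLaw_succ (t : ℝ) (k : ℕ) {f : HeisenbergSpace → ENNReal}
    (hf : Measurable f) :
    ∫⁻ p, f p ∂walkLaw t (k + 1) =
      ∫⁻ q, ∫⁻ s, f (heisenbergMul (horizontal t q) s) ∂walkLaw t k ∂planeGaussian := by
  rw [walkLaw, lintegral_map hf (by fun_prop), lintegral_prod _ (by fun_prop)]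

/-- The steps are i.i.d., so the new one may be multiplied on either side; by induction,
associativity moves it across. The left form yields the recursion of the averages, the right form
the motion of the walk itself. -/
lemma lintegral_walkLaw_succ' (t : ℝ) (k : ℕ) {f : HeisenbergSpace → ENNReal}
    (hf : Measurable f) :
    ∫⁻ p, f p ∂walkLaw t (k + 1) =
      ∫⁻ s, ∫⁻ q, f (heisenbergMul s (horizontal t q)) ∂planeGaussian ∂walkLaw t k := by
  induction k generalizing f with
  | zero =>
    rw [lintegral_walkLaw_succ t 0 hf, walkLaw,
      lintegral_dirac' _ (Measurable.lintegral_prod_right' (f := fun z : HeisenbergSpace × (ℝ × ℝ)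
        => f (heisenbergMul z.1 (horizontal t z.2))) (by fun_prop))]
    refine lintegral_congr fun q => ?_
    rw [lintegral_dirac' _ (by fun_prop), heisenbergMul_zero, zero_heisenbergMul]
  | succ k ih =>
    have hF : Measurable fun s => ∫⁻ q, f (heisenbergMul s (horizontal t q)) ∂planeGaussian :=
      Measurable.lintegral_prod_right' (f := fun z : HeisenbergSpace × (ℝ × ℝ)
        => f (heisenbergMul z.1 (horizontal t z.2))) (by fun_prop)
    rw [lintegral_walkLaw_succ t (k + 1) hf, lintegral_walkLaw_succ t k hF]
    refine lintegral_congr fun q => ?_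
    rw [ih (f := fun p => f (heisenbergMul (horizontal t q) p)) (by fun_prop)]
    simp only [heisenbergMul_assoc]

lemma walkLaw_succ' (t : ℝ) (k : ℕ) :
    walkLaw t (k + 1) = ((walkLaw t k).prod planeGaussian).map
      fun z => heisenbergMul z.1 (horizontal t z.2) := by
  refine Measure.ext_of_lintegral _ fun f hf => ?_
  rw [lintegral_walkLaw_succ' t k hf, lintegral_map hf (by fun_prop),
    lintegral_prod _ (by fun_prop)]

lemma map_neg_planeGaussian : planeGaussian.map (fun q => -q) = planeGaussian := by
  have h : (fun q : ℝ × ℝ => -q) = Prod.map (fun x => -x) (fun x => -x) := rfl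
  rw [h, planeGaussian, ← Measure.map_prod_map _ _ measurable_neg measurable_neg,
    gaussianReal_map_neg, neg_zero]

/-- The random walk is invariant in law under inversion. -/
lemma map_neg_walkLaw (t : ℝ) (k : ℕ) : (walkLaw t k).map (fun p => -p) = walkLaw t k := by
  induction k with
  | zero => simp [walkLaw, Measure.map_dirac' measurable_neg]
  | succ k ih =>
    refine Measure.ext_of_lintegral _ fun f hf => ?_
    -- Inversion reverses products. Expanding one side with the new step on the left and the other
    -- with it on the right makes the two match, given the symmetry of the Gaussian step.
    rw [lintegral_map hf measurable_neg, lintegral_walkLaw_succ t k (by fun_prop),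
      lintegral_walkLaw_succ' t k hf]
    simp_rw [neg_heisenbergMul]
    rw [lintegral_lintegral_swap (by fun_prop)]
    conv_rhs => rw [← ih]
    rw [lintegral_map (Measurable.lintegral_prod_right' (f := fun z : HeisenbergSpace × (ℝ × ℝ)
        => f (heisenbergMul z.1 (horizontal t z.2))) (by fun_prop)) measurable_neg]
    refine lintegral_congr fun s => ?_
    conv_rhs => rw [← map_neg_planeGaussian]
    rw [lintegral_map (by fun_prop) measurable_neg]
    refine lintegral_congr fun q => ?_
    simp [horizontal]

/-! ### Gaussian marginals and moments uniform along the walk. -/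

lemma gaussianReal_eq_map_sqrt (v : ℝ≥0) :
    gaussianReal 0 v = (gaussianReal 0 1).map (fun x => √(v : ℝ) * x) := by
  rw [gaussianReal_map_const_mul]
  congr 1
  · simp
  · ext; simp

lemma gaussianReal_integrable_pow (v : ℝ≥0) (m : ℕ) :
    Integrable (fun x : ℝ => x ^ m) (gaussianReal 0 v) := by
  have h := (memLp_id_gaussianReal (μ := 0) (v := v) (m : ℝ≥0)).integrable_norm_pow'
  refine h.mono' (by fun_prop) (ae_of_all _ fun x => by simp)

lemma integral_gaussianReal_pow_le {v : ℝ≥0} (hv : v ≤ 1) (m : ℕ) :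
    ∫ x, x ^ (2 * m) ∂gaussianReal 0 v ≤ ∫ x, x ^ (2 * m) ∂gaussianReal 0 1 := by
  rw [gaussianReal_eq_map_sqrt v, integral_map (by fun_prop) (by fun_prop)]
  refine integral_mono ?_ (gaussianReal_integrable_pow 1 _) fun x => ?_
  · simp_rw [mul_pow]; exact (gaussianReal_integrable_pow 1 _).const_mul _
  · simp only [mul_pow, pow_mul]
    rw [Real.sq_sqrt (NNReal.coe_nonneg v)]
    exact mul_le_of_le_one_left (by positivity) (pow_le_one₀ v.2 (by exact_mod_cast hv))

/-- The first coordinate is a homomorphism to (ℝ, +), so the walk projects to a sum of k independent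
Gaussians of variance t². -/
lemma map_fst_walkLaw (t : ℝ) (k : ℕ) :
    (walkLaw t k).map (fun p => p.1) = gaussianReal 0 (k * Real.toNNReal (t ^ 2)) := by
  induction k with
  | zero => simp [walkLaw, Measure.map_dirac' measurable_fst]
  | succ k ih =>
    have h : gaussianReal 0 (Real.toNNReal (t ^ 2))
        = planeGaussian.map (fun q => t * q.1) := by
      have : (fun q : ℝ × ℝ => t * q.1) = (fun x => t * x) ∘ Prod.fst := rfl
      rw [this, ← Measure.map_map (by fun_prop) measurable_fst, planeGaussian,
        Measure.map_fst_prod, measure_univ, one_smul, gaussianReal_map_const_mul]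
      congr 1
      · simp
      · ext; simp [sq_nonneg]
    have e : ((k + 1 : ℕ) : ℝ≥0) * Real.toNNReal (t ^ 2)
        = Real.toNNReal (t ^ 2) + k * Real.toNNReal (t ^ 2) := by push_cast; ring
    rw [walkLaw, Measure.map_map measurable_fst (by fun_prop), e, ← zero_add (0 : ℝ),
      ← gaussianReal_conv_gaussianReal, ← ih, h, Measure.conv,
      Measure.map_prod_map _ _ (by fun_prop) (by fun_prop),
      Measure.map_map (by fun_prop) (by fun_prop)]
    rfl

lemma map_snd_walkLaw (t : ℝ) (k : ℕ) :
    (walkLaw t k).map (fun p => p.2.1) = gaussianReal 0 (k * Real.toNNReal (t ^ 2)) := by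
  induction k with
  | zero => simp [walkLaw]
  | succ k ih =>
    have h : gaussianReal 0 (Real.toNNReal (t ^ 2))
        = planeGaussian.map (fun q => t * q.2) := by
      have : (fun q : ℝ × ℝ => t * q.2) = (fun x => t * x) ∘ Prod.snd := rfl
      rw [this, ← Measure.map_map (by fun_prop) measurable_snd, planeGaussian,
        Measure.map_snd_prod, measure_univ, one_smul, gaussianReal_map_const_mul]
      congr 1
      · simp
      · ext; simp [sq_nonneg]
    have e : ((k + 1 : ℕ) : ℝ≥0) * Real.toNNReal (t ^ 2)
        = Real.toNNReal (t ^ 2) + k * Real.toNNReal (t ^ 2) := by push_cast; ring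
    rw [walkLaw, Measure.map_map (by fun_prop) (by fun_prop), e, ← zero_add (0 : ℝ),
      ← gaussianReal_conv_gaussianReal, ← ih, h, Measure.conv,
      Measure.map_prod_map _ _ (by fun_prop) (by fun_prop),
      Measure.map_map (by fun_prop) (by fun_prop)]
    rfl

lemma one_add_add_pow_le (a b : ℝ) (m : ℕ) :
    (1 + a ^ 2 + b ^ 2) ^ m ≤ 3 ^ m * (1 + a ^ (2 * m) + b ^ (2 * m)) := by
  set c := max 1 (max (a ^ 2) (b ^ 2)) with hc
  have h1 : 1 ≤ c := le_max_left _ _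
  have h2 : a ^ 2 ≤ c := (le_max_left _ _).trans (le_max_right _ _)
  have h3 : b ^ 2 ≤ c := (le_max_right _ _).trans (le_max_right _ _)
  have ha : 0 ≤ (a ^ 2) ^ m := by positivity
  have hb : 0 ≤ (b ^ 2) ^ m := by positivity
  calc (1 + a ^ 2 + b ^ 2) ^ m ≤ (3 * c) ^ m := by gcongr; linarith
    _ = 3 ^ m * c ^ m := mul_pow _ _ _
    _ ≤ 3 ^ m * (1 + a ^ (2 * m) + b ^ (2 * m)) := by
      gcongr
      rw [pow_mul, pow_mul]
      rcases max_choice 1 (max (a ^ 2) (b ^ 2)) with h | h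
      · rw [hc, h, one_pow]; linarith
      · rcases max_choice (a ^ 2) (b ^ 2) with h' | h' <;> rw [hc, h, h'] <;> linarith

/-- The constant bounding the `m`-th moment of the weight. -/
noncomputable def weightMoment (m : ℕ) : ℝ :=
  3 ^ m * (1 + ∫ x, x ^ (2 * m) ∂gaussianReal 0 1 + ∫ x, x ^ (2 * m) ∂gaussianReal 0 1)

lemma weightMoment_nonneg (m : ℕ) : 0 ≤ weightMoment m := by
  have : 0 ≤ ∫ x, x ^ (2 * m) ∂gaussianReal 0 1 :=
    integral_nonneg fun x => by rw [pow_mul]; positivity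
  unfold weightMoment; positivity

lemma integrable_walkLaw_fst_pow (t : ℝ) (k m : ℕ) :
    Integrable (fun p : HeisenbergSpace => p.1 ^ m) (walkLaw t k) := by
  have h := gaussianReal_integrable_pow (k * Real.toNNReal (t ^ 2)) m
  rw [← map_fst_walkLaw] at h
  exact (integrable_map_measure (g := fun x : ℝ => x ^ m) (by fun_prop) (by fun_prop)).1 h

lemma integrable_walkLaw_snd_pow (t : ℝ) (k m : ℕ) :
    Integrable (fun p : HeisenbergSpace => p.2.1 ^ m) (walkLaw t k) := by
  have h := gaussianReal_integrable_pow (k * Real.toNNReal (t ^ 2)) m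
  rw [← map_snd_walkLaw] at h
  exact (integrable_map_measure (g := fun x : ℝ => x ^ m) (by fun_prop) (by fun_prop)).1 h

lemma integrable_heisenbergWeight_pow (t : ℝ) (k m : ℕ) :
    Integrable (fun p => heisenbergWeight p ^ m) (walkLaw t k) := by
  refine ((((integrable_const 1).add (integrable_walkLaw_fst_pow t k (2 * m))).add
    (integrable_walkLaw_snd_pow t k (2 * m))).const_mul (3 ^ m)).mono' (by fun_prop)
    (ae_of_all _ fun p => ?_)
  rw [Real.norm_of_nonneg (pow_nonneg (zero_le_one.trans (one_le_heisenbergWeight p)) m)]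
  exact one_add_add_pow_le _ _ m

/-- The coordinates have variance k t² ≤ 1, so their even moments are dominated by those of a
standard Gaussian. Uniformity in k and t is what lets the one-step errors be summed. -/
lemma integral_heisenbergWeight_pow_le {t : ℝ} {k : ℕ} (h : k * t ^ 2 ≤ 1) (m : ℕ) :
    ∫ p, heisenbergWeight p ^ m ∂walkLaw t k ≤ weightMoment m := by
  have hv : (k : ℝ≥0) * Real.toNNReal (t ^ 2) ≤ 1 := by
    rw [← NNReal.coe_le_coe]; simpa [sq_nonneg] using h
  have hx := integrable_walkLaw_fst_pow t k (2 * m)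
  have hy := integrable_walkLaw_snd_pow t k (2 * m)
  have e1 : ∫ p, p.1 ^ (2 * m) ∂walkLaw t k ≤ ∫ x, x ^ (2 * m) ∂gaussianReal 0 1 := by
    rw [← integral_map (f := fun x : ℝ => x ^ (2 * m)) (φ := fun p : HeisenbergSpace => p.1)
      (by fun_prop) (by fun_prop), map_fst_walkLaw]
    exact integral_gaussianReal_pow_le hv m
  have e2 : ∫ p, p.2.1 ^ (2 * m) ∂walkLaw t k ≤ ∫ x, x ^ (2 * m) ∂gaussianReal 0 1 := by
    rw [← integral_map (f := fun x : ℝ => x ^ (2 * m)) (φ := fun p : HeisenbergSpace => p.2.1)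
      (by fun_prop) (by fun_prop), map_snd_walkLaw]
    exact integral_gaussianReal_pow_le hv m
  calc ∫ p, heisenbergWeight p ^ m ∂walkLaw t k
      ≤ ∫ p, 3 ^ m * (1 + p.1 ^ (2 * m) + p.2.1 ^ (2 * m)) ∂walkLaw t k :=
        integral_mono (integrable_heisenbergWeight_pow t k m)
          ((((integrable_const 1).add hx).add hy).const_mul _)
          fun p => one_add_add_pow_le _ _ m
    _ = 3 ^ m * (1 + ∫ p, p.1 ^ (2 * m) ∂walkLaw t k + ∫ p, p.2.1 ^ (2 * m) ∂walkLaw t k) := by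
        have h1 : Integrable (fun p : HeisenbergSpace => 1 + p.1 ^ (2 * m)) (walkLaw t k) :=
          (integrable_const 1).add hx
        rw [integral_const_mul, integral_add h1 hy, integral_add (integrable_const 1) hx]
        simp
    _ ≤ weightMoment m := by unfold weightMoment; gcongr

lemma integrable_planeWeight_pow (m : ℕ) :
    Integrable (fun q => planeWeight q ^ m) planeGaussian := by
  have hx : Integrable (fun q : ℝ × ℝ => q.1 ^ (2 * m)) planeGaussian :=
    (gaussianReal_integrable_pow 1 (2 * m)).comp_fst _
  have hy : Integrable (fun q : ℝ × ℝ => q.2 ^ (2 * m)) planeGaussian :=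
    (gaussianReal_integrable_pow 1 (2 * m)).comp_snd _
  refine ((((integrable_const 1).add hx).add hy).const_mul (3 ^ m)).mono' (by fun_prop)
    (ae_of_all _ fun p => ?_)
  rw [Real.norm_of_nonneg (pow_nonneg (zero_le_one.trans (one_le_planeWeight p)) m)]
  exact one_add_add_pow_le _ _ m

lemma Tame.integrable_walkLaw {φ : HeisenbergSpace → ℝ} (h : Tame heisenbergWeight φ)
    (t : ℝ) (k : ℕ) : Integrable φ (walkLaw t k) :=
  h.integrable (integrable_heisenbergWeight_pow t k)

lemma Tame.integrable_planeGaussian {φ : ℝ × ℝ → ℝ} (h : Tame planeWeight φ) :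
    Integrable φ planeGaussian :=
  h.integrable integrable_planeWeight_pow

lemma Tame.fst_plane : Tame planeWeight fun q => q.1 :=
  ⟨measurable_fst, 1, 1, zero_le_one, fun q => by
    rw [one_mul, pow_one, planeWeight, abs_le]
    constructor <;> nlinarith [sq_nonneg (q.1 + 1), sq_nonneg (q.1 - 1), sq_nonneg q.2]⟩

lemma Tame.snd_plane : Tame planeWeight fun q => q.2 :=
  ⟨measurable_snd, 1, 1, zero_le_one, fun q => by
    rw [one_mul, pow_one, planeWeight, abs_le]
    constructor <;> nlinarith [sq_nonneg (q.2 + 1), sq_nonneg (q.2 - 1), sq_nonneg q.1]⟩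

lemma abs_fst_le_heisenbergWeight (p : HeisenbergSpace) : |p.1| ≤ heisenbergWeight p := by
  rw [heisenbergWeight, abs_le]
  constructor <;> nlinarith [sq_nonneg (p.1 + 1), sq_nonneg (p.1 - 1), sq_nonneg p.2.1]

lemma abs_snd_le_heisenbergWeight (p : HeisenbergSpace) : |p.2.1| ≤ heisenbergWeight p := by
  rw [heisenbergWeight, abs_le]
  constructor <;> nlinarith [sq_nonneg (p.2.1 + 1), sq_nonneg (p.2.1 - 1), sq_nonneg p.1]

lemma Tame.fst_heisenberg : Tame heisenbergWeight fun p => p.1 :=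
  ⟨measurable_fst, 1, 1, zero_le_one, fun p => by
    simpa using abs_fst_le_heisenbergWeight p⟩

lemma Tame.snd_heisenberg : Tame heisenbergWeight fun p => p.2.1 :=
  ⟨by fun_prop, 1, 1, zero_le_one, fun p => by
    simpa using abs_snd_le_heisenbergWeight p⟩

/-- Along a horizontal step, polynomial growth is inherited. -/
lemma Tame.comp_step {φ : HeisenbergSpace → ℝ} (h : Tame heisenbergWeight φ) {t : ℝ}
    (ht : t ^ 2 ≤ 1) (p : HeisenbergSpace) :
    Tame planeWeight fun q => φ (heisenbergMul p (horizontal t q)) := by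
  obtain ⟨hm, C, m, hC, h⟩ := h
  refine ⟨by fun_prop, C * (2 * heisenbergWeight p) ^ m, m, ?_, fun q => (h _).trans ?_⟩
  · have := one_le_heisenbergWeight p; positivity
  · rw [mul_assoc, ← mul_pow]
    have := one_le_heisenbergWeight (heisenbergMul p (horizontal t q))
    gcongr
    exact heisenbergWeight_mul_horizontal_le ht p q

lemma integral_walkLaw_succ {t : ℝ} {k : ℕ} {φ : HeisenbergSpace → ℝ}
    (h : Integrable φ (walkLaw t (k + 1))) :
    ∫ p, φ p ∂walkLaw t (k + 1) =
      ∫ q, ∫ s, φ (heisenbergMul (horizontal t q) s) ∂walkLaw t k ∂planeGaussian := by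
  have h' := h
  rw [walkLaw] at h' ⊢
  rw [integral_map (by fun_prop) h'.aestronglyMeasurable, integral_prod]
  exact (integrable_map_measure h'.aestronglyMeasurable (by fun_prop)).1 h'

lemma integral_walkLaw_succ' {t : ℝ} {k : ℕ} {φ : HeisenbergSpace → ℝ}
    (h : Integrable φ (walkLaw t (k + 1))) :
    ∫ p, φ p ∂walkLaw t (k + 1) =
      ∫ s, ∫ q, φ (heisenbergMul s (horizontal t q)) ∂planeGaussian ∂walkLaw t k := by
  have h' := h
  rw [walkLaw_succ'] at h' ⊢
  rw [integral_map (by fun_prop) h'.aestronglyMeasurable, integral_prod]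
  exact (integrable_map_measure h'.aestronglyMeasurable (by fun_prop)).1 h'

/-! ### Averages of a regular function along the random walk -/

/-- `g` takes values in `[ε, K]` with `ε > 0`, has continuous partial derivatives bounded by `K`,
and its first-order Taylor remainder is at most `K |d|²`. -/
structure IsUniformlyRegular (g : HeisenbergSpace → ℝ) (ε K : ℝ) : Prop where
  pos : 0 < ε
  lower : ∀ p, ε ≤ g p
  upper : ∀ p, g p ≤ K
  diff : Differentiable ℝ g
  contX : Continuous (partialX g)
  contY : Continuous (partialY g)
  contZ : Continuous (partialZ g)
  boundX : ∀ p, |partialX g p| ≤ K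
  boundY : ∀ p, |partialY g p| ≤ K
  boundZ : ∀ p, |partialZ g p| ≤ K
  taylor : ∀ p d, |g (p + d) - g p -
    (partialX g p * d.1 + partialY g p * d.2.1 + partialZ g p * d.2.2)| ≤
      K * (d.1 ^ 2 + d.2.1 ^ 2 + d.2.2 ^ 2)

lemma fderiv_apply_eq_partials (g : HeisenbergSpace → ℝ) (p d : HeisenbergSpace) :
    fderiv ℝ g p d = partialX g p * d.1 + partialY g p * d.2.1 + partialZ g p * d.2.2 := by
  have h : d = d.1 • ((1, 0, 0) : HeisenbergSpace) + d.2.1 • ((0, 1, 0) : HeisenbergSpace)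
      + d.2.2 • ((0, 0, 1) : HeisenbergSpace) := by
    ext <;> simp
  conv_lhs => rw [h]
  simp only [map_add, map_smul, smul_eq_mul, partialX, partialY, partialZ]
  ring

/-- The average of `g (p · S)` over the position `S` of the walk. -/
noncomputable def walkMean (g : HeisenbergSpace → ℝ) (t : ℝ) (j : ℕ) (p : HeisenbergSpace) : ℝ :=
  ∫ s, g (heisenbergMul p s) ∂walkLaw t j

/-- The derivative of `walkMean` along the first left-invariant field. -/
noncomputable def walkX (g : HeisenbergSpace → ℝ) (t : ℝ) (j : ℕ) (p : HeisenbergSpace) : ℝ :=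
  ∫ s, (partialX g (heisenbergMul p s) +
    (s.2.1 - p.2.1) / 2 * partialZ g (heisenbergMul p s)) ∂walkLaw t j

/-- The derivative of `walkMean` along the second left-invariant field. -/
noncomputable def walkY (g : HeisenbergSpace → ℝ) (t : ℝ) (j : ℕ) (p : HeisenbergSpace) : ℝ :=
  ∫ s, (partialY g (heisenbergMul p s) +
    (p.1 - s.1) / 2 * partialZ g (heisenbergMul p s)) ∂walkLaw t j

/-- The derivative of `walkMean` along the central field. -/
noncomputable def walkZ (g : HeisenbergSpace → ℝ) (t : ℝ) (j : ℕ) (p : HeisenbergSpace) : ℝ :=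
  ∫ s, partialZ g (heisenbergMul p s) ∂walkLaw t j

lemma integral_sub_sub {α : Type*} [MeasurableSpace α] {μ : Measure α} {f g h : α → ℝ}
    (hf : Integrable f μ) (hg : Integrable g μ) (hh : Integrable h μ) :
    ∫ x, (f x - g x - h x) ∂μ = ∫ x, f x ∂μ - ∫ x, g x ∂μ - ∫ x, h x ∂μ := by
  have := integral_sub (hf.sub hg) hh
  simp only [Pi.sub_apply] at this
  rw [this, integral_sub hf hg]

/-- **Stein's lemma** for bounded functions with bounded continuous derivative. -/
lemma integral_deriv_gaussianReal {φ φ' : ℝ → ℝ} (hφ : ∀ x, HasDerivAt φ (φ' x) x)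
    (hc : Continuous φ') {K D : ℝ} (hK : ∀ x, |φ x| ≤ K) (hD : ∀ x, |φ' x| ≤ D) :
    ∫ x, φ' x ∂gaussianReal 0 1 = ∫ x, x * φ x ∂gaussianReal 0 1 := by
  have hρ : ∀ x, HasDerivAt (gaussianPDFReal 0 1) (-x * gaussianPDFReal 0 1 x) x := fun x => by
    have h : HasDerivAt (fun x : ℝ => (√(2 * Real.pi * ((1 : ℝ≥0) : ℝ)))⁻¹ *
        Real.exp (-(x - 0) ^ 2 / (2 * ((1 : ℝ≥0) : ℝ))))
        ((√(2 * Real.pi * ((1 : ℝ≥0) : ℝ)))⁻¹ *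
          (Real.exp (-(x - 0) ^ 2 / (2 * ((1 : ℝ≥0) : ℝ))) * (-x))) x := by
      refine HasDerivAt.const_mul _ (HasDerivAt.exp ?_)
      have := (((hasDerivAt_id x).sub_const 0).pow 2).neg.div_const (2 * ((1 : ℝ≥0) : ℝ))
      refine this.congr_deriv ?_
      simp
      ring
    rw [gaussianPDFReal_def]
    refine h.congr_deriv ?_
    ring
  have hφm : Continuous φ := continuous_iff_continuousAt.2 fun x => (hφ x).continuousAt
  have hi : Integrable φ (gaussianReal 0 1) :=
    (integrable_const K).mono' hφm.aestronglyMeasurable (ae_of_all _ hK)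
  have hi' : Integrable φ' (gaussianReal 0 1) :=
    (integrable_const D).mono' hc.aestronglyMeasurable (ae_of_all _ hD)
  have hix : Integrable (fun x => x * φ x) (gaussianReal 0 1) := by
    have := (gaussianReal_integrable_pow 1 1).mul_bdd (c := K) hφm.aestronglyMeasurable
      (ae_of_all _ hK)
    simpa using this
  have key : ∀ {ψ : ℝ → ℝ}, Integrable ψ (gaussianReal 0 1) →
      Integrable (fun x => gaussianPDFReal 0 1 x • ψ x) := fun {ψ} h => by
    rw [gaussianReal_of_var_ne_zero _ one_ne_zero,
      integrable_withDensity_iff_integrable_smul' (measurable_gaussianPDF _ _)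
      (ae_of_all _ fun _ => gaussianPDF_lt_top)] at h
    simpa [toReal_gaussianPDF] using h
  -- With ρ the Gaussian density, (ρφ)' = ρφ' - xρφ, and the integral of the derivative of an
  -- integrable function over the line vanishes.
  have h0 : ∫ x, (gaussianPDFReal 0 1 x • φ' x - gaussianPDFReal 0 1 x • (x * φ x)) = 0 := by
    refine integral_eq_zero_of_hasDerivAt_of_integrable (f := fun x => gaussianPDFReal 0 1 x • φ x)
      (fun x => ?_) ((key hi').sub (key hix)) (key hi)
    refine ((hρ x).mul (hφ x)).congr_deriv ?_
    simp only [smul_eq_mul]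
    ring
  rw [integral_sub (key hi') (key hix)] at h0
  rw [integral_gaussianReal_eq_integral_smul one_ne_zero,
    integral_gaussianReal_eq_integral_smul one_ne_zero]
  linarith

namespace IsUniformlyRegular

variable {g : HeisenbergSpace → ℝ} {ε K : ℝ}

lemma K_pos (hg : IsUniformlyRegular g ε K) : 0 < K := hg.pos.trans_le ((hg.lower 0).trans (hg.upper 0))

lemma abs_le (hg : IsUniformlyRegular g ε K) (p : HeisenbergSpace) : |g p| ≤ K := by
  rw [abs_of_nonneg (hg.pos.le.trans (hg.lower p))]; exact hg.upper p

lemma measurable (hg : IsUniformlyRegular g ε K) : Measurable g := hg.diff.continuous.measurable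

lemma measurableX (hg : IsUniformlyRegular g ε K) : Measurable (partialX g) := hg.contX.measurable
lemma measurableY (hg : IsUniformlyRegular g ε K) : Measurable (partialY g) := hg.contY.measurable
lemma measurableZ (hg : IsUniformlyRegular g ε K) : Measurable (partialZ g) := hg.contZ.measurable

lemma tame_mean (hg : IsUniformlyRegular g ε K) (p : HeisenbergSpace) :
    Tame heisenbergWeight fun s => g (heisenbergMul p s) :=
  Tame.of_bounded (by have := hg.measurable; fun_prop) fun _ => hg.abs_le _

lemma tame_Z (hg : IsUniformlyRegular g ε K) (p : HeisenbergSpace) :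
    Tame heisenbergWeight fun s => partialZ g (heisenbergMul p s) :=
  Tame.of_bounded (by have := hg.measurableZ; fun_prop) fun _ => hg.boundZ _

lemma tame_X (hg : IsUniformlyRegular g ε K) (p : HeisenbergSpace) :
    Tame heisenbergWeight fun s => partialX g (heisenbergMul p s) +
      (s.2.1 - p.2.1) / 2 * partialZ g (heisenbergMul p s) := by
  refine Tame.add one_le_heisenbergWeight
    (Tame.of_bounded (by have := hg.measurableX; fun_prop) fun _ => hg.boundX _) ?_
  refine Tame.mul ?_ (hg.tame_Z p)
  convert (Tame.snd_heisenberg.sub one_le_heisenbergWeight (Tame.const p.2.1)).const_mul (1 / 2)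
    using 2
  ring

lemma tame_Y (hg : IsUniformlyRegular g ε K) (p : HeisenbergSpace) :
    Tame heisenbergWeight fun s => partialY g (heisenbergMul p s) +
      (p.1 - s.1) / 2 * partialZ g (heisenbergMul p s) := by
  refine Tame.add one_le_heisenbergWeight
    (Tame.of_bounded (by have := hg.measurableY; fun_prop) fun _ => hg.boundY _) ?_
  refine Tame.mul ?_ (hg.tame_Z p)
  convert ((Tame.const p.1).sub one_le_heisenbergWeight Tame.fst_heisenberg).const_mul (1 / 2)
    using 2
  ring

lemma measurable_walkMean (hg : IsUniformlyRegular g ε K) (t : ℝ) (j : ℕ) : Measurable (walkMean g t j) := by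
  have := hg.measurable
  exact (StronglyMeasurable.integral_prod_right' (f := fun z : HeisenbergSpace × HeisenbergSpace =>
    g (heisenbergMul z.1 z.2)) (Measurable.stronglyMeasurable (by fun_prop))).measurable

lemma measurable_walkX (hg : IsUniformlyRegular g ε K) (t : ℝ) (j : ℕ) : Measurable (walkX g t j) := by
  have := hg.measurableX
  have := hg.measurableZ
  exact (StronglyMeasurable.integral_prod_right' (f := fun z : HeisenbergSpace × HeisenbergSpace =>
    partialX g (heisenbergMul z.1 z.2) + (z.2.2.1 - z.1.2.1) / 2 *
      partialZ g (heisenbergMul z.1 z.2)) (Measurable.stronglyMeasurable (by fun_prop))).measurable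

lemma measurable_walkY (hg : IsUniformlyRegular g ε K) (t : ℝ) (j : ℕ) : Measurable (walkY g t j) := by
  have := hg.measurableY
  have := hg.measurableZ
  exact (StronglyMeasurable.integral_prod_right' (f := fun z : HeisenbergSpace × HeisenbergSpace =>
    partialY g (heisenbergMul z.1 z.2) + (z.1.1 - z.2.1) / 2 *
      partialZ g (heisenbergMul z.1 z.2)) (Measurable.stronglyMeasurable (by fun_prop))).measurable

lemma measurable_walkZ (hg : IsUniformlyRegular g ε K) (t : ℝ) (j : ℕ) : Measurable (walkZ g t j) := by
  have := hg.measurableZ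
  exact (StronglyMeasurable.integral_prod_right' (f := fun z : HeisenbergSpace × HeisenbergSpace =>
    partialZ g (heisenbergMul z.1 z.2)) (Measurable.stronglyMeasurable (by fun_prop))).measurable

/-! ### One-step recursions for the averages and their left-invariant derivatives. -/

lemma walkMean_zero (hg : IsUniformlyRegular g ε K) (t : ℝ) (p : HeisenbergSpace) :
    walkMean g t 0 p = g p := by
  have := hg.measurable
  rw [walkMean, walkLaw, integral_dirac' _ _ (Measurable.stronglyMeasurable (by fun_prop)),
    heisenbergMul_zero]

lemma walkX_zero (hg : IsUniformlyRegular g ε K) (t : ℝ) (p : HeisenbergSpace) :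
    walkX g t 0 p = partialX g p - p.2.1 / 2 * partialZ g p := by
  rw [walkX, walkLaw, integral_dirac' _ _ (hg.tame_X p).1.stronglyMeasurable,
    heisenbergMul_zero]
  simp; ring

lemma walkY_zero (hg : IsUniformlyRegular g ε K) (t : ℝ) (p : HeisenbergSpace) :
    walkY g t 0 p = partialY g p + p.1 / 2 * partialZ g p := by
  rw [walkY, walkLaw, integral_dirac' _ _ (hg.tame_Y p).1.stronglyMeasurable,
    heisenbergMul_zero]
  simp

lemma walkZ_zero (hg : IsUniformlyRegular g ε K) (t : ℝ) (p : HeisenbergSpace) :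
    walkZ g t 0 p = partialZ g p := by
  rw [walkZ, walkLaw, integral_dirac' _ _ (hg.tame_Z p).1.stronglyMeasurable,
    heisenbergMul_zero]

lemma walkMean_succ (hg : IsUniformlyRegular g ε K) (t : ℝ) (j : ℕ) (p : HeisenbergSpace) :
    walkMean g t (j + 1) p =
      ∫ q, walkMean g t j (heisenbergMul p (horizontal t q)) ∂planeGaussian := by
  rw [walkMean, integral_walkLaw_succ ((hg.tame_mean p).integrable_walkLaw t (j + 1))]
  simp only [walkMean, heisenbergMul_assoc]

lemma walkZ_succ (hg : IsUniformlyRegular g ε K) (t : ℝ) (j : ℕ) (p : HeisenbergSpace) :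
    walkZ g t (j + 1) p =
      ∫ q, walkZ g t j (heisenbergMul p (horizontal t q)) ∂planeGaussian := by
  rw [walkZ, integral_walkLaw_succ ((hg.tame_Z p).integrable_walkLaw t (j + 1))]
  simp only [walkZ, heisenbergMul_assoc]

/-- This is [X, Y] = Z in discrete form: carrying X from p to p · (tu, tv, 0) shifts its central
coefficient by tv/2 from the base point and tv/2 from the translation, whence the extra term tv Z.
The derivatives are defined under the integral sign, so `walkMean` itself never has to be
differentiated. -/
lemma walkX_succ (hg : IsUniformlyRegular g ε K) (t : ℝ) (j : ℕ) (p : HeisenbergSpace) :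
    walkX g t (j + 1) p =
      ∫ q, (walkX g t j (heisenbergMul p (horizontal t q)) +
        t * q.2 * walkZ g t j (heisenbergMul p (horizontal t q))) ∂planeGaussian := by
  rw [walkX, integral_walkLaw_succ ((hg.tame_X p).integrable_walkLaw t (j + 1))]
  refine integral_congr_ae (ae_of_all _ fun q => ?_)
  simp only [walkX, walkZ]
  rw [← integral_const_mul, ← integral_add ((hg.tame_X _).integrable_walkLaw t j)
    (((hg.tame_Z _).const_mul _).integrable_walkLaw t j)]
  refine integral_congr_ae (ae_of_all _ fun s => ?_)
  simp only [heisenbergMul_assoc]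
  simp only [heisenbergMul, horizontal]
  ring

lemma walkY_succ (hg : IsUniformlyRegular g ε K) (t : ℝ) (j : ℕ) (p : HeisenbergSpace) :
    walkY g t (j + 1) p =
      ∫ q, (walkY g t j (heisenbergMul p (horizontal t q)) -
        t * q.1 * walkZ g t j (heisenbergMul p (horizontal t q))) ∂planeGaussian := by
  rw [walkY, integral_walkLaw_succ ((hg.tame_Y p).integrable_walkLaw t (j + 1))]
  refine integral_congr_ae (ae_of_all _ fun q => ?_)
  simp only [walkY, walkZ]
  rw [← integral_const_mul, ← integral_sub ((hg.tame_Y _).integrable_walkLaw t j)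
    (((hg.tame_Z _).const_mul _).integrable_walkLaw t j)]
  refine integral_congr_ae (ae_of_all _ fun s => ?_)
  simp only [heisenbergMul_assoc]
  simp only [heisenbergMul, horizontal]
  ring

/-! ### Bounds uniform along the walk, and the one-step expansion. -/

lemma le_walkMean (hg : IsUniformlyRegular g ε K) (t : ℝ) (j : ℕ) (p : HeisenbergSpace) :
    ε ≤ walkMean g t j p := by
  have := integral_mono (integrable_const ε) ((hg.tame_mean p).integrable_walkLaw t j)
    fun s => hg.lower _
  simpa [walkMean] using this

lemma walkMean_le (hg : IsUniformlyRegular g ε K) (t : ℝ) (j : ℕ) (p : HeisenbergSpace) :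
    walkMean g t j p ≤ K := by
  have := integral_mono ((hg.tame_mean p).integrable_walkLaw t j) (integrable_const K)
    fun s => hg.upper _
  simpa [walkMean] using this

lemma integral_abs_le {φ : HeisenbergSpace → ℝ} {D : ℝ} (hD : 0 ≤ D) {t : ℝ} {j : ℕ}
    (h : j * t ^ 2 ≤ 1) (hφ : ∀ s, |φ s| ≤ D * heisenbergWeight s) :
    |∫ s, φ s ∂walkLaw t j| ≤ D * weightMoment 1 := by
  have hw := integrable_heisenbergWeight_pow t j 1
  have hm := integral_heisenbergWeight_pow_le h 1
  simp only [pow_one] at hw hm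
  calc |∫ s, φ s ∂walkLaw t j| ≤ ∫ s, D * heisenbergWeight s ∂walkLaw t j :=
        norm_integral_le_of_norm_le (f := φ) (hw.const_mul D) (ae_of_all _ hφ)
    _ = D * ∫ s, heisenbergWeight s ∂walkLaw t j := integral_const_mul _ _
    _ ≤ D * weightMoment 1 := by gcongr

lemma abs_walkZ_le (hg : IsUniformlyRegular g ε K) {t : ℝ} {j : ℕ} (h : j * t ^ 2 ≤ 1)
    (p : HeisenbergSpace) : |walkZ g t j p| ≤ 2 * K * weightMoment 1 * heisenbergWeight p := by
  have hK := hg.K_pos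
  have hp := one_le_heisenbergWeight p
  refine (integral_abs_le (D := 2 * K * heisenbergWeight p) (by positivity) h
    fun s => (hg.boundZ _).trans ?_).trans_eq (by ring)
  have hs := one_le_heisenbergWeight s
  nlinarith [mul_le_mul hp hs zero_le_one (zero_le_one.trans hp)]

/-- Common bound for the integrands of `walkX` and `walkY`; for `walkY` the roles of P and S are
exchanged. -/
lemma abs_add_half_le (hK : 0 ≤ K) {a c y z P S : ℝ} (ha : |a| ≤ K) (hc : |c| ≤ K)
    (hP : 1 ≤ P) (hS : 1 ≤ S) (hy : |y| ≤ S) (hz : |z| ≤ P) :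
    |a + (y - z) / 2 * c| ≤ 2 * K * P * S := by
  have h1 : |(y - z) / 2 * c| ≤ (S + P) / 2 * K := by
    rw [abs_mul, abs_div, abs_two]
    have : |y - z| ≤ S + P := (abs_sub _ _).trans (add_le_add hy hz)
    gcongr
  have h2 := abs_add_le a ((y - z) / 2 * c)
  have h3 : K * 1 ≤ K * (P * S) := mul_le_mul_of_nonneg_left (one_le_mul_of_one_le_of_one_le hP hS) hK
  have h4 : K * (S + P) ≤ K * (2 * (P * S)) :=
    mul_le_mul_of_nonneg_left (by nlinarith) hK
  linarith

lemma abs_walkX_le (hg : IsUniformlyRegular g ε K) {t : ℝ} {j : ℕ} (h : j * t ^ 2 ≤ 1)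
    (p : HeisenbergSpace) : |walkX g t j p| ≤ 2 * K * weightMoment 1 * heisenbergWeight p := by
  have hK := hg.K_pos
  have hp := one_le_heisenbergWeight p
  refine (integral_abs_le (D := 2 * K * heisenbergWeight p) (by positivity) h
    fun s => ?_).trans_eq (by ring)
  exact abs_add_half_le hK.le (hg.boundX _) (hg.boundZ _) hp (one_le_heisenbergWeight s)
    (abs_snd_le_heisenbergWeight s) (abs_snd_le_heisenbergWeight p)

lemma abs_walkY_le (hg : IsUniformlyRegular g ε K) {t : ℝ} {j : ℕ} (h : j * t ^ 2 ≤ 1)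
    (p : HeisenbergSpace) : |walkY g t j p| ≤ 2 * K * weightMoment 1 * heisenbergWeight p := by
  have hK := hg.K_pos
  have hp := one_le_heisenbergWeight p
  refine (integral_abs_le (D := 2 * K * heisenbergWeight p) (by positivity) h
    fun s => ?_).trans_eq (by ring)
  refine (abs_add_half_le hK.le (hg.boundY _) (hg.boundZ _) (one_le_heisenbergWeight s) hp
    (abs_fst_le_heisenbergWeight p) (abs_fst_le_heisenbergWeight s)).trans_eq (by ring)

/-- First-order expansion of the averages along a horizontal step. -/
lemma abs_walkMean_sub_le (hg : IsUniformlyRegular g ε K) {t : ℝ} {j : ℕ} (h : j * t ^ 2 ≤ 1)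
    (p : HeisenbergSpace) (q : ℝ × ℝ) :
    |walkMean g t j (heisenbergMul p (horizontal t q)) - walkMean g t j p -
      t * (q.1 * walkX g t j p + q.2 * walkY g t j p)| ≤
      2 * K * weightMoment 1 * t ^ 2 * heisenbergWeight p * planeWeight q := by
  have hK := hg.K_pos
  have hp := one_le_heisenbergWeight p
  have hq := one_le_planeWeight q
  have i1 := (hg.tame_mean (heisenbergMul p (horizontal t q))).integrable_walkLaw t j
  have i2 := (hg.tame_mean p).integrable_walkLaw t j
  have i3 := (hg.tame_X p).integrable_walkLaw t j
  have i4 := (hg.tame_Y p).integrable_walkLaw t j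
  have e : walkMean g t j (heisenbergMul p (horizontal t q)) - walkMean g t j p -
      t * (q.1 * walkX g t j p + q.2 * walkY g t j p) =
      ∫ s, (g (heisenbergMul (heisenbergMul p (horizontal t q)) s) - g (heisenbergMul p s) -
        t * (q.1 * (partialX g (heisenbergMul p s) +
            (s.2.1 - p.2.1) / 2 * partialZ g (heisenbergMul p s)) +
          q.2 * (partialY g (heisenbergMul p s) +
            (p.1 - s.1) / 2 * partialZ g (heisenbergMul p s)))) ∂walkLaw t j := by
    have h5 := integral_sub_sub i1 i2 (((i3.const_mul q.1).add (i4.const_mul q.2)).const_mul t)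
    simp only [Pi.add_apply] at h5
    rw [h5, integral_const_mul, integral_add (i3.const_mul q.1) (i4.const_mul q.2),
      integral_const_mul, integral_const_mul]
    rfl
  rw [e]
  refine (integral_abs_le (D := K * t ^ 2 * heisenbergWeight p * planeWeight q)
    (by positivity) h fun s => ?_).trans ?_
  -- The Euclidean displacement from p · s to p · (tu, tv, 0) · s. It is linear in (u, v), so the
  -- linear Taylor term is exactly t(u X + v Y) under the integral, and |d|² is bounded by t² times
  -- a product of weights.
  · set d : HeisenbergSpace := (t * q.1, t * q.2,
      t * (q.1 * ((s.2.1 - p.2.1) / 2) + q.2 * ((p.1 - s.1) / 2))) with hd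
    have e1 : heisenbergMul (heisenbergMul p (horizontal t q)) s = heisenbergMul p s + d := by
      simp only [heisenbergMul, horizontal, hd, Prod.mk_add_mk, Prod.mk.injEq]
      refine ⟨by ring, by ring, by ring⟩
    have ht := hg.taylor (heisenbergMul p s) d
    rw [← e1] at ht
    have e2 : partialX g (heisenbergMul p s) * d.1 + partialY g (heisenbergMul p s) * d.2.1 +
        partialZ g (heisenbergMul p s) * d.2.2 = t * (q.1 * (partialX g (heisenbergMul p s) +
            (s.2.1 - p.2.1) / 2 * partialZ g (heisenbergMul p s)) +
          q.2 * (partialY g (heisenbergMul p s) +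
            (p.1 - s.1) / 2 * partialZ g (heisenbergMul p s))) := by
      simp only [hd]; ring
    rw [e2] at ht
    refine ht.trans ?_
    have hs := one_le_heisenbergWeight s
    have key : d.1 ^ 2 + d.2.1 ^ 2 + d.2.2 ^ 2 ≤
        t ^ 2 * (heisenbergWeight p * planeWeight q * heisenbergWeight s) := by
      have h1 : (q.1 * ((s.2.1 - p.2.1) / 2) + q.2 * ((p.1 - s.1) / 2)) ^ 2 ≤
          (q.1 ^ 2 + q.2 ^ 2) * (((s.2.1 - p.2.1) / 2) ^ 2 + ((p.1 - s.1) / 2) ^ 2) := by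
        nlinarith [sq_nonneg (q.1 * ((p.1 - s.1) / 2) - q.2 * ((s.2.1 - p.2.1) / 2))]
      have h2 : 1 + (((s.2.1 - p.2.1) / 2) ^ 2 + ((p.1 - s.1) / 2) ^ 2) ≤
          heisenbergWeight p * heisenbergWeight s := by
        unfold heisenbergWeight
        nlinarith [sq_nonneg (p.1 + s.1), sq_nonneg (p.2.1 + s.2.1), sq_nonneg (p.1 * s.1),
          sq_nonneg (p.1 * s.2.1), sq_nonneg (p.2.1 * s.1), sq_nonneg (p.2.1 * s.2.1),
          sq_nonneg p.1, sq_nonneg s.1, sq_nonneg p.2.1, sq_nonneg s.2.1]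
      have h3 : q.1 ^ 2 + q.2 ^ 2 ≤ planeWeight q := by unfold planeWeight; linarith
      have h4 : d.1 ^ 2 + d.2.1 ^ 2 + d.2.2 ^ 2 = t ^ 2 * (q.1 ^ 2 + q.2 ^ 2 +
          (q.1 * ((s.2.1 - p.2.1) / 2) + q.2 * ((p.1 - s.1) / 2)) ^ 2) := by
        simp only [hd]; ring
      rw [h4]
      refine mul_le_mul_of_nonneg_left ?_ (sq_nonneg t)
      calc _ ≤ (q.1 ^ 2 + q.2 ^ 2) *
            (1 + (((s.2.1 - p.2.1) / 2) ^ 2 + ((p.1 - s.1) / 2) ^ 2)) := by linarith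
        _ ≤ planeWeight q * (heisenbergWeight p * heisenbergWeight s) := by
          refine mul_le_mul h3 h2 (by positivity) (by linarith)
        _ = _ := by ring
    calc _ ≤ K * (t ^ 2 * (heisenbergWeight p * planeWeight q * heisenbergWeight s)) := by
          gcongr
      _ = _ := by ring
  · have := weightMoment_nonneg 1
    have h5 : 0 ≤ K * weightMoment 1 * t ^ 2 * heisenbergWeight p * planeWeight q := by positivity
    linarith

/-- The curve is affine in u, so its central speed t(s.2.1 - p.2.1)/2 involves the base point p and
not the moving point. The difference between the two is the origin of the Z-term in
`integral_rotation`. -/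
lemma hasDerivAt_fst (hg : IsUniformlyRegular g ε K) (t : ℝ) (p s : HeisenbergSpace) (u v : ℝ) :
    HasDerivAt (fun u => g (heisenbergMul (heisenbergMul p (horizontal t (u, v))) s))
      (t * (partialX g (heisenbergMul (heisenbergMul p (horizontal t (u, v))) s) +
        (s.2.1 - p.2.1) / 2 *
          partialZ g (heisenbergMul (heisenbergMul p (horizontal t (u, v))) s))) u := by
  have h : HasDerivAt (fun u => heisenbergMul (heisenbergMul p (horizontal t (u, v))) s)
      ((t, 0, t * ((s.2.1 - p.2.1) / 2)) : HeisenbergSpace) u := by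
    have e : (fun u => heisenbergMul (heisenbergMul p (horizontal t (u, v))) s) = fun u =>
        u • ((t, 0, t * ((s.2.1 - p.2.1) / 2)) : HeisenbergSpace) +
          heisenbergMul (heisenbergMul p (horizontal t (0, v))) s := by
      funext u
      simp only [heisenbergMul, horizontal, Prod.smul_mk, Prod.mk_add_mk, smul_eq_mul,
        Prod.mk.injEq]
      refine ⟨by ring, by ring, by ring⟩
    rw [e]
    simpa using ((hasDerivAt_id u).smul_const
      ((t, 0, t * ((s.2.1 - p.2.1) / 2)) : HeisenbergSpace)).add_const
        (heisenbergMul (heisenbergMul p (horizontal t (0, v))) s)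
  have := (hg.diff _).hasFDerivAt.comp_hasDerivAt u h
  rw [fderiv_apply_eq_partials] at this
  refine this.congr_deriv ?_
  ring

lemma hasDerivAt_snd (hg : IsUniformlyRegular g ε K) (t : ℝ) (p s : HeisenbergSpace) (u v : ℝ) :
    HasDerivAt (fun v => g (heisenbergMul (heisenbergMul p (horizontal t (u, v))) s))
      (t * (partialY g (heisenbergMul (heisenbergMul p (horizontal t (u, v))) s) +
        (p.1 - s.1) / 2 *
          partialZ g (heisenbergMul (heisenbergMul p (horizontal t (u, v))) s))) v := by
  have h : HasDerivAt (fun v => heisenbergMul (heisenbergMul p (horizontal t (u, v))) s)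
      ((0, t, t * ((p.1 - s.1) / 2)) : HeisenbergSpace) v := by
    have e : (fun v => heisenbergMul (heisenbergMul p (horizontal t (u, v))) s) = fun v =>
        v • ((0, t, t * ((p.1 - s.1) / 2)) : HeisenbergSpace) +
          heisenbergMul (heisenbergMul p (horizontal t (u, 0))) s := by
      funext v
      simp only [heisenbergMul, horizontal, Prod.smul_mk, Prod.mk_add_mk, smul_eq_mul,
        Prod.mk.injEq]
      refine ⟨by ring, by ring, by ring⟩
    rw [e]
    simpa using ((hasDerivAt_id v).smul_const
      ((0, t, t * ((p.1 - s.1) / 2)) : HeisenbergSpace)).add_const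
        (heisenbergMul (heisenbergMul p (horizontal t (u, 0))) s)
  have := (hg.diff _).hasFDerivAt.comp_hasDerivAt v h
  rw [fderiv_apply_eq_partials] at this
  refine this.congr_deriv ?_
  ring

/-- Rotational invariance of the Gaussian step, with the remaining steps frozen. -/
lemma integral_rotation_frozen (hg : IsUniformlyRegular g ε K) {t : ℝ} (ht : t ≠ 0)
    (p s : HeisenbergSpace) :
    ∫ q : ℝ × ℝ, (q.1 * (partialY g (heisenbergMul (heisenbergMul p (horizontal t q)) s) +
        (p.1 - s.1) / 2 * partialZ g (heisenbergMul (heisenbergMul p (horizontal t q)) s)) -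
      q.2 * (partialX g (heisenbergMul (heisenbergMul p (horizontal t q)) s) +
        (s.2.1 - p.2.1) / 2 * partialZ g (heisenbergMul (heisenbergMul p (horizontal t q)) s)))
      ∂planeGaussian = 0 := by
  have hK := hg.K_pos
  have hp := one_le_heisenbergWeight p
  have hs := one_le_heisenbergWeight s
  set D := 2 * K * heisenbergWeight p * heisenbergWeight s with hD
  set k : ℝ × ℝ → ℝ := fun q => g (heisenbergMul (heisenbergMul p (horizontal t q)) s) with hk
  set ku : ℝ × ℝ → ℝ := fun q => partialX g (heisenbergMul (heisenbergMul p (horizontal t q)) s) +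
    (s.2.1 - p.2.1) / 2 * partialZ g (heisenbergMul (heisenbergMul p (horizontal t q)) s) with hku
  set kv : ℝ × ℝ → ℝ := fun q => partialY g (heisenbergMul (heisenbergMul p (horizontal t q)) s) +
    (p.1 - s.1) / 2 * partialZ g (heisenbergMul (heisenbergMul p (horizontal t q)) s) with hkv
  have hcomp : Continuous fun q => heisenbergMul (heisenbergMul p (horizontal t q)) s := by
    unfold heisenbergMul horizontal; fun_prop
  have cku : Continuous ku :=
    (hg.contX.comp hcomp).add (continuous_const.mul (hg.contZ.comp hcomp))
  have ckv : Continuous kv :=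
    (hg.contY.comp hcomp).add (continuous_const.mul (hg.contZ.comp hcomp))
  have bku : ∀ q, |ku q| ≤ D := fun q => abs_add_half_le hK.le (hg.boundX _) (hg.boundZ _) hp hs
    (abs_snd_le_heisenbergWeight s) (abs_snd_le_heisenbergWeight p)
  have bkv : ∀ q, |kv q| ≤ D := fun q =>
    (abs_add_half_le hK.le (hg.boundY _) (hg.boundZ _) hs hp
    (abs_fst_le_heisenbergWeight p) (abs_fst_le_heisenbergWeight s)).trans_eq (by rw [hD]; ring)
  have tk : Tame planeWeight k :=
    Tame.of_bounded (hg.diff.continuous.comp hcomp).measurable fun _ => hg.abs_le _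
  have tku : Tame planeWeight ku := Tame.of_bounded cku.measurable bku
  have tkv : Tame planeWeight kv := Tame.of_bounded ckv.measurable bkv
  have i1 : Integrable (fun q => q.1 * kv q) planeGaussian :=
    (Tame.fst_plane.mul tkv).integrable_planeGaussian
  have i2 : Integrable (fun q => q.2 * ku q) planeGaussian :=
    (Tame.snd_plane.mul tku).integrable_planeGaussian
  have i3 : Integrable (fun q => q.1 * (q.2 * k q)) planeGaussian :=
    (Tame.fst_plane.mul (Tame.snd_plane.mul tk)).integrable_planeGaussian
  have stein1 : ∀ v, t * ∫ u, ku (u, v) ∂gaussianReal 0 1 =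
      ∫ u, u * k (u, v) ∂gaussianReal 0 1 := fun v => by
    rw [← integral_const_mul]
    refine integral_deriv_gaussianReal (K := K) (D := |t| * D)
      (fun u => hg.hasDerivAt_fst t p s u v) (by fun_prop) (fun _ => hg.abs_le _) fun u => ?_
    rw [abs_mul]
    exact mul_le_mul_of_nonneg_left (bku _) (abs_nonneg t)
  have stein2 : ∀ u, t * ∫ v, kv (u, v) ∂gaussianReal 0 1 =
      ∫ v, v * k (u, v) ∂gaussianReal 0 1 := fun u => by
    rw [← integral_const_mul]
    refine integral_deriv_gaussianReal (K := K) (D := |t| * D)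
      (fun v => hg.hasDerivAt_snd t p s u v) (by fun_prop) (fun _ => hg.abs_le _) fun v => ?_
    rw [abs_mul]
    exact mul_le_mul_of_nonneg_left (bkv _) (abs_nonneg t)
  -- Stein's lemma in v, respectively in u, turns both t ∫ u k_v and t ∫ v k_u into ∫ u v k. Their
  -- equality is the vanishing mean of the rotation field.
  have e1 : t * ∫ q, q.1 * kv q ∂planeGaussian = ∫ q, q.1 * (q.2 * k q) ∂planeGaussian := by
    unfold planeGaussian at i1 i3 ⊢
    rw [integral_prod _ i1, integral_prod _ i3, ← integral_const_mul]
    refine integral_congr_ae (ae_of_all _ fun u => ?_)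
    simp only [integral_const_mul]
    rw [← stein2 u, mul_left_comm]
  have e2 : t * ∫ q, q.2 * ku q ∂planeGaussian = ∫ q, q.1 * (q.2 * k q) ∂planeGaussian := by
    unfold planeGaussian at i2 i3 ⊢
    rw [integral_prod_symm _ i2, integral_prod_symm _ i3, ← integral_const_mul]
    refine integral_congr_ae (ae_of_all _ fun v => ?_)
    simp only [integral_const_mul, mul_left_comm _ v]
    rw [← stein1 v, mul_left_comm]
  rw [integral_sub i1 i2]
  have : t * (∫ q, q.1 * kv q ∂planeGaussian - ∫ q, q.2 * ku q ∂planeGaussian) = 0 := by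
    rw [mul_sub, e1, e2, sub_self]
  exact (mul_eq_zero.1 this).resolve_left ht

/-- Rotational invariance of the Gaussian step, in terms of the left-invariant derivatives. -/
lemma integral_rotation (hg : IsUniformlyRegular g ε K) {t : ℝ} (ht : t ≠ 0) (j : ℕ)
    (p : HeisenbergSpace) :
    ∫ q : ℝ × ℝ, (q.1 * walkY g t j (heisenbergMul p (horizontal t q)) -
      q.2 * walkX g t j (heisenbergMul p (horizontal t q)) -
      t / 2 * (q.1 ^ 2 + q.2 ^ 2) * walkZ g t j (heisenbergMul p (horizontal t q)))
      ∂planeGaussian = 0 := by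
  have hK := hg.K_pos
  have hp := one_le_heisenbergWeight p
  set F : (ℝ × ℝ) × HeisenbergSpace → ℝ := fun z =>
    z.1.1 * (partialY g (heisenbergMul (heisenbergMul p (horizontal t z.1)) z.2) +
        (p.1 - z.2.1) / 2 *
          partialZ g (heisenbergMul (heisenbergMul p (horizontal t z.1)) z.2)) -
      z.1.2 * (partialX g (heisenbergMul (heisenbergMul p (horizontal t z.1)) z.2) +
        (z.2.2.1 - p.2.1) / 2 *
          partialZ g (heisenbergMul (heisenbergMul p (horizontal t z.1)) z.2)) with hF
  -- Passing from the base point p · (tu, tv, 0) to p changes the Y- and X-coefficients of Z by tu/2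
  -- and -tv/2. Together these contribute t(u² + v²)/2 times Z, which the third term removes.
  have e : ∀ q : ℝ × ℝ, q.1 * walkY g t j (heisenbergMul p (horizontal t q)) -
      q.2 * walkX g t j (heisenbergMul p (horizontal t q)) -
      t / 2 * (q.1 ^ 2 + q.2 ^ 2) * walkZ g t j (heisenbergMul p (horizontal t q)) =
      ∫ s, F (q, s) ∂walkLaw t j := fun q => by
    have i1 := ((hg.tame_Y (heisenbergMul p (horizontal t q))).const_mul q.1).integrable_walkLaw t j
    have i2 := ((hg.tame_X (heisenbergMul p (horizontal t q))).const_mul q.2).integrable_walkLaw t j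
    have i3 := ((hg.tame_Z (heisenbergMul p (horizontal t q))).const_mul
      (t / 2 * (q.1 ^ 2 + q.2 ^ 2))).integrable_walkLaw t j
    simp only [walkX, walkY, walkZ]
    rw [← integral_const_mul, ← integral_const_mul, ← integral_const_mul,
      ← integral_sub_sub i1 i2 i3]
    refine integral_congr_ae (ae_of_all _ fun s => ?_)
    simp only [hF]
    simp only [heisenbergMul, horizontal]
    ring
  have hint : Integrable F (planeGaussian.prod (walkLaw t j)) := by
    have h1 := integrable_planeWeight_pow 1
    have h2 := integrable_heisenbergWeight_pow t j 1
    simp only [pow_one] at h1 h2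
    refine ((h1.mul_prod h2).const_mul (4 * K * heisenbergWeight p)).mono' ?_
      (ae_of_all _ fun z => ?_)
    · have := hg.measurableX
      have := hg.measurableY
      have := hg.measurableZ
      exact Measurable.aestronglyMeasurable (by fun_prop)
    · have hs := one_le_heisenbergWeight z.2
      have bku := abs_add_half_le hK.le
        (hg.boundX (heisenbergMul (heisenbergMul p (horizontal t z.1)) z.2))
        (hg.boundZ (heisenbergMul (heisenbergMul p (horizontal t z.1)) z.2)) hp hs
        (abs_snd_le_heisenbergWeight z.2) (abs_snd_le_heisenbergWeight p)
      have bkv := abs_add_half_le hK.le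
        (hg.boundY (heisenbergMul (heisenbergMul p (horizontal t z.1)) z.2))
        (hg.boundZ (heisenbergMul (heisenbergMul p (horizontal t z.1)) z.2)) hs hp
        (abs_fst_le_heisenbergWeight p) (abs_fst_le_heisenbergWeight z.2)
      have hu : |z.1.1| ≤ planeWeight z.1 := by
        rw [planeWeight, _root_.abs_le]
        constructor <;> nlinarith [sq_nonneg (z.1.1 + 1), sq_nonneg (z.1.1 - 1), sq_nonneg z.1.2]
      have hv : |z.1.2| ≤ planeWeight z.1 := by
        rw [planeWeight, _root_.abs_le]
        constructor <;> nlinarith [sq_nonneg (z.1.2 + 1), sq_nonneg (z.1.2 - 1), sq_nonneg z.1.1]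
      have hw : 0 ≤ planeWeight z.1 := zero_le_one.trans (one_le_planeWeight _)
      simp only [hF, Real.norm_eq_abs]
      refine (abs_sub _ _).trans ?_
      rw [abs_mul, abs_mul]
      have h3 := mul_le_mul hu bkv (abs_nonneg _) hw
      have h4 := mul_le_mul hv bku (abs_nonneg _) hw
      refine (add_le_add h3 h4).trans_eq ?_
      ring
  simp_rw [e]
  rw [integral_integral_swap (f := fun q s => F (q, s)) hint]
  simp only [hF]
  simp_rw [hg.integral_rotation_frozen ht p]
  simp

end IsUniformlyRegular

/-! ### One-step estimates on the plane -/

/-- The moments of the planar weight under the standard Gaussian measure. -/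
noncomputable def planeMoment (m : ℕ) : ℝ := ∫ q, planeWeight q ^ m ∂planeGaussian

lemma one_le_planeMoment (m : ℕ) : 1 ≤ planeMoment m := by
  have := integral_mono (integrable_const (1 : ℝ)) (integrable_planeWeight_pow m)
    fun q => one_le_pow₀ (one_le_planeWeight q)
  simpa [planeMoment] using this

lemma integral_sq_gaussianReal : ∫ x, x ^ 2 ∂gaussianReal 0 1 = 1 := by
  have h := variance_of_integral_eq_zero (X := fun x : ℝ => x) (μ := gaussianReal 0 1)
    (by fun_prop) (by simp)
  rw [variance_fun_id_gaussianReal] at h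
  simpa using h.symm

lemma integral_linear_sq_planeGaussian (x y : ℝ) :
    ∫ q : ℝ × ℝ, (x * q.1 + y * q.2) ^ 2 ∂planeGaussian = x ^ 2 + y ^ 2 := by
  have i1 : Integrable (fun q : ℝ × ℝ => q.1 ^ 2) planeGaussian :=
    (Tame.fst_plane.pow 2).integrable_planeGaussian
  have i2 : Integrable (fun q : ℝ × ℝ => q.1 * q.2) planeGaussian :=
    (Tame.fst_plane.mul Tame.snd_plane).integrable_planeGaussian
  have i3 : Integrable (fun q : ℝ × ℝ => q.2 ^ 2) planeGaussian :=
    (Tame.snd_plane.pow 2).integrable_planeGaussian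
  have e1 : ∫ q : ℝ × ℝ, q.1 ^ 2 ∂planeGaussian = 1 := by
    rw [planeGaussian, integral_fun_fst (f := fun x : ℝ => x ^ 2), integral_sq_gaussianReal]
    simp
  have e3 : ∫ q : ℝ × ℝ, q.2 ^ 2 ∂planeGaussian = 1 := by
    rw [planeGaussian, integral_fun_snd (f := fun x : ℝ => x ^ 2), integral_sq_gaussianReal]
    simp
  have e2 : ∫ q : ℝ × ℝ, q.1 * q.2 ∂planeGaussian = 0 := by
    rw [planeGaussian, integral_prod_mul (fun x : ℝ => x) (fun y : ℝ => y)]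
    simp
  have e : ∀ q : ℝ × ℝ, (x * q.1 + y * q.2) ^ 2 =
      (x ^ 2 * q.1 ^ 2 + 2 * x * y * (q.1 * q.2)) + y ^ 2 * q.2 ^ 2 := fun q => by ring
  simp_rw [e]
  have h := integral_add ((i1.const_mul (x ^ 2)).add (i2.const_mul (2 * x * y)))
    (i3.const_mul (y ^ 2))
  have h' := integral_add (i1.const_mul (x ^ 2)) (i2.const_mul (2 * x * y))
  simp only [Pi.add_apply] at h
  rw [h, h', integral_const_mul, integral_const_mul, integral_const_mul, e1, e2, e3]
  ring

/-- Young's inequality with a free weight; below, k depends on the point through 1/G. -/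
lemma mul_le_half_mul_sq_add {k : ℝ} (hk : 0 < k) (x y : ℝ) :
    x * y ≤ 1 / 2 * (k * x ^ 2 + y ^ 2 / k) := by
  have : 0 ≤ (k * x - y) ^ 2 / k := by positivity
  have e : (k * x - y) ^ 2 / k = k * x ^ 2 - 2 * (x * y) + y ^ 2 / k := by field_simp; ring
  linarith

/-- Only t² m l² matters at order t². Replacing G by its mean m costs one more factor t, as do the
quadratic part of the error and its product with l. -/
lemma weighted_error_le {t L M S w l r σ G m : ℝ} (ht : 0 < t) (ht1 : t ≤ 1) (hG : 0 < G)
    (hGL : G ≤ L) (hM : 1 ≤ M) (hw : 1 ≤ w) (hr : 0 ≤ r) (hrw : r ≤ w) (hl : l ^ 2 ≤ S * w)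
    (hσ : σ ^ 2 ≤ S) (hGm : G - m ≤ 2 * L * t * M * w) :
    G * (t * l - 1 / 2 * σ * t ^ 2 * r) ^ 2 ≤
      t ^ 2 * m * l ^ 2 + 4 * t ^ 3 * L * M * S * w ^ 2 := by
  have hS : 0 ≤ S := (sq_nonneg σ).trans hσ
  have hL : 0 < L := hG.trans_le hGL
  have hw2 : w ≤ w ^ 2 := le_self_pow₀ hw two_ne_zero
  have h1 : S * w ≤ S * w ^ 2 := by gcongr
  have h2 : σ ^ 2 * r ^ 2 ≤ S * w ^ 2 := by gcongr
  have h3 : -(σ * l * r) ≤ S * w ^ 2 := by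
    have : 0 ≤ (σ * r + l) ^ 2 := sq_nonneg _
    have e : (σ * r + l) ^ 2 = σ ^ 2 * r ^ 2 + 2 * (σ * l * r) + l ^ 2 := by ring
    linarith
  have h4 : t / 4 * (σ ^ 2 * r ^ 2) ≤ 1 * (S * w ^ 2) := by
    have : t / 4 ≤ 1 := by linarith
    gcongr
  have h5 : (t * l - 1 / 2 * σ * t ^ 2 * r) ^ 2 ≤ t ^ 2 * l ^ 2 + t ^ 3 * (2 * S * w ^ 2) := by
    have e : (t * l - 1 / 2 * σ * t ^ 2 * r) ^ 2 =
        t ^ 2 * l ^ 2 + t ^ 3 * (-(σ * l * r) + t / 4 * (σ ^ 2 * r ^ 2)) := by ring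
    rw [e]
    gcongr
    linarith
  have h6 : (G - m) * (t ^ 2 * l ^ 2) ≤ 2 * L * t * M * w * (t ^ 2 * (S * w)) :=
    (mul_le_mul_of_nonneg_right hGm (by positivity)).trans (by gcongr)
  have h7 : L * t ^ 3 * S * w ^ 2 * 1 ≤ L * t ^ 3 * S * w ^ 2 * M := by gcongr
  calc G * (t * l - 1 / 2 * σ * t ^ 2 * r) ^ 2
      ≤ G * (t ^ 2 * l ^ 2 + t ^ 3 * (2 * S * w ^ 2)) := by gcongr
    _ = m * (t ^ 2 * l ^ 2) + (G - m) * (t ^ 2 * l ^ 2) + G * (t ^ 3 * (2 * S * w ^ 2)) := by ring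
    _ ≤ m * (t ^ 2 * l ^ 2) + 2 * L * t * M * w * (t ^ 2 * (S * w)) +
        L * (t ^ 3 * (2 * S * w ^ 2)) := by gcongr
    _ ≤ _ := by linarith

/-- One step of the gradient estimate, on the plane of increments. -/
lemma gradient_step_plane {ν ε K L t : ℝ} (hν : 0 < ν) (hε : 0 < ε) (ht : 0 < t) (ht1 : t ≤ 1)
    (hL : K ≤ L) {G a b c : ℝ × ℝ → ℝ} (hG : Tame planeWeight G) (ha : Tame planeWeight a)
    (hb : Tame planeWeight b) (hc : Tame planeWeight c) (hGε : ∀ q, ε ≤ G q) (hGK : ∀ q, G q ≤ K)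
    {g₀ : ℝ} (hG0 : ∀ q, |G q - g₀| ≤ L * t * planeWeight q)
    (hrot : ∫ q, (q.1 * b q - q.2 * a q - t / 2 * (q.1 ^ 2 + q.2 ^ 2) * c q) ∂planeGaussian = 0)
    {α β σ m : ℝ} (hα : α = ∫ q, (a q + t * q.2 * c q) ∂planeGaussian)
    (hβ : β = ∫ q, (b q - t * q.1 * c q) ∂planeGaussian) (hσ : σ = ∫ q, c q ∂planeGaussian)
    (hm : m = ∫ q, G q ∂planeGaussian) :
    (α ^ 2 + β ^ 2 + ν * σ ^ 2) / m ≤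
      (1 + t ^ 2 / ν + 4 * planeMoment 1 * planeMoment 2 * (1 + 1 / ν) / (ε * ν) * L * t ^ 3) *
        ∫ q, (a q ^ 2 + b q ^ 2 + ν * c q ^ 2) / G q ∂planeGaussian := by
  have hω := one_le_planeWeight
  have hM1 := one_le_planeMoment 1
  have hM2 := one_le_planeMoment 2
  have iG := hG.integrable_planeGaussian
  have hεm : ε ≤ m := by
    rw [hm]; simpa using integral_mono (integrable_const ε) iG hGε
  have hm0 : 0 < m := hε.trans_le hεm
  have hK : 0 < K := hε.trans_le ((hGε 0).trans (hGK 0))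
  have hL0 : 0 < L := hK.trans_le hL
  set N := α ^ 2 + β ^ 2 + ν * σ ^ 2 with hN
  set S := α ^ 2 + β ^ 2 + σ ^ 2 with hS
  have hN0 : 0 ≤ N := by positivity
  have hS0 : 0 ≤ S := by positivity
  set I := ∫ q, (a q ^ 2 + b q ^ 2 + ν * c q ^ 2) / G q ∂planeGaussian with hI
  -- These are the coefficients of a, b, c in α·(formula for α) + β·(formula for β) + νσ·(formula
  -- for σ) + σt·(rotation identity). The multiplier σt is the one for which the cross terms cancel:
  -- C = νσ + E, and A² + B² + C²/ν = N + E²/ν exactly.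
  set A := fun q : ℝ × ℝ => α - σ * t * q.2
  set B := fun q : ℝ × ℝ => β + σ * t * q.1
  set C := fun q : ℝ × ℝ => α * t * q.2 - β * t * q.1 + ν * σ - 1 / 2 * σ * t ^ 2 *
    (q.1 ^ 2 + q.2 ^ 2)
  set E := fun q : ℝ × ℝ => t * (-β * q.1 + α * q.2) - 1 / 2 * σ * t ^ 2 * (q.1 ^ 2 + q.2 ^ 2)
  have tu := Tame.fst_plane
  have tv := Tame.snd_plane
  have tr : Tame planeWeight fun q => q.1 ^ 2 + q.2 ^ 2 := (tu.pow 2).add hω (tv.pow 2)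
  have hE : Tame planeWeight E := by
    refine Tame.sub hω (((tu.const_mul _).add hω (tv.const_mul _)).const_mul _) (tr.const_mul _)
  have hΦ : Tame planeWeight fun q => (a q ^ 2 + b q ^ 2 + ν * c q ^ 2) / G q := by
    simp only [div_eq_mul_inv]
    refine Tame.mul (((ha.pow 2).add hω (hb.pow 2)).add hω ((hc.pow 2).const_mul ν)) ?_
    refine Tame.of_bounded hG.1.inv (C := ε⁻¹) fun q => ?_
    rw [abs_of_pos (inv_pos.2 (hε.trans_le (hGε q)))]
    exact inv_anti₀ hε (hGε q)
  have hlinT : Tame planeWeight fun q => (a q * A q + b q * B q) + c q * C q := by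
    refine Tame.add hω ((ha.mul ?_).add hω (hb.mul ?_)) (hc.mul ?_)
    · exact (Tame.const α).sub hω (tv.const_mul _)
    · exact (Tame.const β).add hω (tu.const_mul _)
    · exact (((tv.const_mul _).sub hω (tu.const_mul _)).add hω (Tame.const _)).sub hω
        (tr.const_mul _)
  have hlin : N = ∫ q, ((a q * A q + b q * B q) + c q * C q) ∂planeGaussian := by
    have i1 : Integrable (fun q => a q + t * q.2 * c q) planeGaussian :=
      (ha.add hω ((tv.const_mul t).mul hc)).integrable_planeGaussian
    have i2 : Integrable (fun q => b q - t * q.1 * c q) planeGaussian :=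
      (hb.sub hω ((tu.const_mul t).mul hc)).integrable_planeGaussian
    have i3 := hc.integrable_planeGaussian
    have i4 : Integrable (fun q => q.1 * b q - q.2 * a q - t / 2 * (q.1 ^ 2 + q.2 ^ 2) * c q)
        planeGaussian := (((tu.mul hb).sub hω (tv.mul ha)).sub hω
          ((tr.const_mul (t / 2)).mul hc)).integrable_planeGaussian
    have h := integral_add (((i1.const_mul α).add (i2.const_mul β)).add (i3.const_mul (ν * σ)))
      (i4.const_mul (σ * t))
    have h' := integral_add ((i1.const_mul α).add (i2.const_mul β)) (i3.const_mul (ν * σ))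
    have h'' := integral_add (i1.const_mul α) (i2.const_mul β)
    simp only [Pi.add_apply] at h h' h''
    rw [h', h'', integral_const_mul, integral_const_mul, integral_const_mul, integral_const_mul,
      ← hα, ← hβ, ← hσ, hrot] at h
    have e : N = α * α + β * β + ν * σ * σ + σ * t * 0 := by rw [hN]; ring
    rw [e, ← h]
    refine integral_congr_ae (ae_of_all _ fun q => ?_)
    simp only [A, B, C]; ring
  have hEbound : ∀ q, G q * E q ^ 2 ≤ t ^ 2 * m * (-β * q.1 + α * q.2) ^ 2 +
      4 * t ^ 3 * L * planeMoment 1 * S * planeWeight q ^ 2 := fun q => by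
    have hq := hω q
    set l := -β * q.1 + α * q.2 with hl
    set r := q.1 ^ 2 + q.2 ^ 2 with hr
    have hr0 : 0 ≤ r := by positivity
    have hrω : r ≤ planeWeight q := by rw [hr, planeWeight]; linarith
    have hl2 : l ^ 2 ≤ S * planeWeight q := by
      have h1 : l ^ 2 ≤ (α ^ 2 + β ^ 2) * r := by
        rw [hl, hr]; nlinarith [sq_nonneg (β * q.2 + α * q.1)]
      refine h1.trans (mul_le_mul ?_ hrω hr0 hS0)
      rw [hS]; linarith [sq_nonneg σ]
    have hGm : G q - m ≤ 2 * L * t * planeMoment 1 * planeWeight q := by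
      have h1 := (abs_le.1 (hG0 q)).2
      have h2 : g₀ - m ≤ L * t * planeMoment 1 := by
        have h3 : g₀ - L * t * planeMoment 1 =
            ∫ q, (g₀ - L * t * planeWeight q ^ 1) ∂planeGaussian := by
          rw [integral_sub (integrable_const _) ((integrable_planeWeight_pow 1).const_mul _),
            integral_const_mul]
          simp [planeMoment]
        have h4 : ∫ q, (g₀ - L * t * planeWeight q ^ 1) ∂planeGaussian ≤ m := by
          rw [hm]
          refine integral_mono ((integrable_const _).sub
            ((integrable_planeWeight_pow 1).const_mul _)) iG fun q => ?_
          have := (abs_le.1 (hG0 q)).1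
          simp only [pow_one]; linarith
        linarith
      have h5 : L * t * planeWeight q ≤ L * t * (planeMoment 1 * planeWeight q) := by
        gcongr; exact le_mul_of_one_le_left (by linarith) hM1
      have h6 : L * t * planeMoment 1 ≤ L * t * (planeMoment 1 * planeWeight q) := by
        gcongr; exact le_mul_of_one_le_right (by linarith) hq
      linarith
    have hσS : σ ^ 2 ≤ S := by rw [hS]; linarith [sq_nonneg α, sq_nonneg β]
    exact weighted_error_le ht ht1 (hε.trans_le (hGε q)) ((hGK q).trans hL) hM1 hq hr0 hrω hl2 hσS
      hGm
  -- To leading order this is t² m (α² + β²), by isotropy of the Gaussian. The remainder is made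
  -- proportional to N m through S ≤ (1 + 1/ν) N and 1 ≤ m/ε, so that the error becomes relative.
  have hEint : ∫ q, G q * E q ^ 2 ∂planeGaussian ≤
      N * m * (t ^ 2 + 4 * planeMoment 1 * planeMoment 2 * (1 + 1 / ν) / ε * L * t ^ 3) := by
    have i1 : Integrable (fun q : ℝ × ℝ => t ^ 2 * m * (-β * q.1 + α * q.2) ^ 2) planeGaussian :=
      ((((tu.const_mul (-β)).add hω (tv.const_mul α)).pow 2).const_mul
        (t ^ 2 * m)).integrable_planeGaussian
    have i2 := (integrable_planeWeight_pow 2).const_mul (4 * t ^ 3 * L * planeMoment 1 * S)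
    have h1 := integral_mono (hG.mul (hE.pow 2)).integrable_planeGaussian (i1.add i2) hEbound
    simp only [Pi.add_apply] at h1
    rw [integral_add i1 i2, integral_const_mul, integral_const_mul,
      integral_linear_sq_planeGaussian] at h1
    change _ ≤ _ + 4 * t ^ 3 * L * planeMoment 1 * S * planeMoment 2 at h1
    have h2 : (-β) ^ 2 + α ^ 2 ≤ N := by rw [hN]; nlinarith [mul_nonneg hν.le (sq_nonneg σ)]
    have h3 : S ≤ N * m * ((1 + 1 / ν) / ε) := by
      have h4 : S ≤ (1 + 1 / ν) * N := by
        have e : (1 + 1 / ν) * N = α ^ 2 + β ^ 2 + σ ^ 2 +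
          (ν * σ ^ 2 + (α ^ 2 + β ^ 2) / ν) := by rw [hN]; field_simp; ring
        rw [e, hS]
        have : 0 ≤ ν * σ ^ 2 + (α ^ 2 + β ^ 2) / ν := by positivity
        linarith
      refine h4.trans ?_
      have h5 : 1 ≤ m / ε := (one_le_div hε).2 hεm
      calc (1 + 1 / ν) * N = (1 + 1 / ν) * N * 1 := by ring
        _ ≤ (1 + 1 / ν) * N * (m / ε) := by gcongr
        _ = _ := by ring
    refine h1.trans ?_
    calc t ^ 2 * m * ((-β) ^ 2 + α ^ 2) + 4 * t ^ 3 * L * planeMoment 1 * S * planeMoment 2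
        ≤ t ^ 2 * m * N +
          4 * t ^ 3 * L * planeMoment 1 * (N * m * ((1 + 1 / ν) / ε)) * planeMoment 2 := by gcongr
      _ = _ := by ring
  set D := 1 + t ^ 2 / ν +
    4 * planeMoment 1 * planeMoment 2 * (1 + 1 / ν) / (ε * ν) * L * t ^ 3 with hD
  have hD0 : 0 < D := by positivity
  set θ := m * D with hθ
  have hθ0 : 0 < θ := mul_pos hm0 hD0
  -- Young's inequality with weights θ/G, θ/G and θν/G, matching the coefficients of the energy a² +
  -- b² + νc² divided by G.
  have hpt : ∀ q, (a q * A q + b q * B q) + c q * C q ≤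
      θ / 2 * ((a q ^ 2 + b q ^ 2 + ν * c q ^ 2) / G q) +
        (1 / (2 * θ) * N * G q + 1 / (2 * θ * ν) * (G q * E q ^ 2)) := fun q => by
    have hGq : 0 < G q := hε.trans_le (hGε q)
    have h1 := mul_le_half_mul_sq_add (div_pos hθ0 hGq) (a q) (A q)
    have h2 := mul_le_half_mul_sq_add (div_pos hθ0 hGq) (b q) (B q)
    have h3 := mul_le_half_mul_sq_add (div_pos (mul_pos hθ0 hν) hGq) (c q) (C q)
    have e : A q ^ 2 + B q ^ 2 + C q ^ 2 / ν = N + E q ^ 2 / ν := by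
      rw [hN]
      simp only [A, B, C, E]
      field_simp
      ring
    have e2 : 1 / 2 * (θ / G q * a q ^ 2 + A q ^ 2 / (θ / G q)) +
        1 / 2 * (θ / G q * b q ^ 2 + B q ^ 2 / (θ / G q)) +
        1 / 2 * (θ * ν / G q * c q ^ 2 + C q ^ 2 / (θ * ν / G q)) =
        θ / 2 * ((a q ^ 2 + b q ^ 2 + ν * c q ^ 2) / G q) +
        1 / (2 * θ) * G q * (A q ^ 2 + B q ^ 2 + C q ^ 2 / ν) := by
      field_simp; ring
    have e3 : 1 / (2 * θ) * G q * (N + E q ^ 2 / ν) =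
        1 / (2 * θ) * N * G q + 1 / (2 * θ * ν) * (G q * E q ^ 2) := by
      field_simp
    rw [e, e3] at e2
    linarith
  have hfin : N ≤ θ / 2 * I + (1 / (2 * θ) * N * m + 1 / (2 * θ * ν) *
      ∫ q, G q * E q ^ 2 ∂planeGaussian) := by
    have i1 := hΦ.integrable_planeGaussian.const_mul (θ / 2)
    have i2 := iG.const_mul (1 / (2 * θ) * N)
    have i3 := (hG.mul (hE.pow 2)).integrable_planeGaussian.const_mul (1 / (2 * θ * ν))
    have h1 := integral_mono hlinT.integrable_planeGaussian (i1.add (i2.add i3)) hpt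
    have h2 := integral_add i1 (i2.add i3)
    have h3 := integral_add i2 i3
    simp only [Pi.add_apply] at h1 h2
    rw [h2, h3, integral_const_mul, integral_const_mul, integral_const_mul, ← hm, ← hlin] at h1
    exact h1
  have h5 : 1 / (2 * θ * ν) * ∫ q, G q * E q ^ 2 ∂planeGaussian ≤
      1 / (2 * θ * ν) * (N * m *
        (t ^ 2 + 4 * planeMoment 1 * planeMoment 2 * (1 + 1 / ν) / ε * L * t ^ 3)) := by
    gcongr
  -- D is defined so that the terms without I add up to N m D/(2θ). With θ = m D this is N/2, which
  -- is absorbed on the left and leaves N ≤ θ I.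
  have h6 : 1 / (2 * θ) * N * m + 1 / (2 * θ * ν) * (N * m *
        (t ^ 2 + 4 * planeMoment 1 * planeMoment 2 * (1 + 1 / ν) / ε * L * t ^ 3)) = N / 2 := by
    have e : 1 / (2 * θ) * N * m + 1 / (2 * θ * ν) * (N * m *
        (t ^ 2 + 4 * planeMoment 1 * planeMoment 2 * (1 + 1 / ν) / ε * L * t ^ 3)) =
        N * (m * D) / (2 * θ) := by
      rw [hD]; field_simp; ring
    rw [e, ← hθ]; field_simp
  rw [div_le_iff₀ hm0]
  have h7 : D * I * m = θ * I := by rw [hθ]; ring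
  rw [h7]
  linarith

/-- For |s| ≤ 1/2 this is Taylor's formula for log. For larger |s|, log(1 + s) ≤ s bounds the left
side by s², which the cubic term already exceeds. -/
lemma one_add_mul_log_le {s : ℝ} (hs : -1 < s) :
    (1 + s) * Real.log (1 + s) - s ≤ s ^ 2 / 2 + 4 * |s| ^ 3 := by
  have h0 : 0 < 1 + s := by linarith
  have hsa := abs_nonneg s
  have hsq : |s| ^ 2 = s ^ 2 := sq_abs s
  rcases le_or_gt |s| (1 / 2) with h | h
  · have h1 := Real.abs_log_sub_add_sum_range_le (x := -s) (by rw [abs_neg]; linarith) 2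
    rw [abs_neg] at h1
    have h2 : |s| ^ (2 + 1) / (1 - |s|) ≤ 2 * |s| ^ 3 := by
      rw [div_le_iff₀ (by linarith)]
      have : 0 ≤ |s| ^ 3 * (1 / 2 - |s|) := mul_nonneg (by positivity) (by linarith)
      norm_num
      linarith
    have h3 := (abs_le.1 (h1.trans h2)).2
    simp only [Finset.sum_range_succ, Finset.sum_range_zero] at h3
    norm_num at h3
    have h4 : Real.log (1 + s) ≤ s - s ^ 2 / 2 + 2 * |s| ^ 3 := by linarith
    have h5 := mul_le_mul_of_nonneg_left h4 h0.le
    have h6 : -s ^ 3 ≤ |s| ^ 3 := by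
      rw [← abs_pow]; exact neg_le_abs _
    have h7 : s ≤ 1 / 2 := (le_abs_self s).trans h
    have h8 : s * |s| ^ 3 ≤ 1 / 2 * |s| ^ 3 := by gcongr
    nlinarith
  · have h1 : Real.log (1 + s) ≤ s := by linarith [Real.log_le_sub_one_of_pos h0]
    have h2 := mul_le_mul_of_nonneg_left h1 h0.le
    have h3 : |s| ^ 3 = |s| * s ^ 2 := by rw [← hsq]; ring
    nlinarith [sq_nonneg s]

lemma mul_log_sub_le {x y : ℝ} (hx : 0 < x) (hy : 0 < y) :
    y * Real.log y - x * Real.log x - (Real.log x + 1) * (y - x) ≤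
      (y - x) ^ 2 / (2 * x) + 4 / x ^ 2 * |y - x| ^ 3 := by
  have h := one_add_mul_log_le (s := (y - x) / x) (by
    rw [lt_div_iff₀ hx]; linarith)
  have e : 1 + (y - x) / x = y / x := by field_simp; ring
  rw [e, Real.log_div hy.ne' hx.ne', abs_div, abs_of_pos hx] at h
  have h' := mul_le_mul_of_nonneg_left h hx.le
  have e1 : x * (y / x * (Real.log y - Real.log x) - (y - x) / x) =
      y * Real.log y - x * Real.log x - (Real.log x + 1) * (y - x) := by field_simp; ring
  have e2 : x * (((y - x) / x) ^ 2 / 2 + 4 * (|y - x| / x) ^ 3) =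
      (y - x) ^ 2 / (2 * x) + 4 / x ^ 2 * |y - x| ^ 3 := by field_simp
  rwa [e1, e2] at h'

/-- Convexity of u log u: the graph lies above its tangent at x. -/
lemma mul_log_sub_nonneg {x y : ℝ} (hx : 0 < x) (hy : 0 < y) :
    0 ≤ y * Real.log y - x * Real.log x - (Real.log x + 1) * (y - x) := by
  have h := Real.log_le_sub_one_of_pos (div_pos hx hy)
  rw [Real.log_div hx.ne' hy.ne'] at h
  have h' := mul_le_mul_of_nonneg_left h hy.le
  have e : y * (x / y - 1) = x - y := by field_simp
  rw [e] at h'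
  linarith

lemma Tame.mul_log {α : Type*} [MeasurableSpace α] {W G : α → ℝ} {ε K : ℝ} (hε : 0 < ε)
    (hG : Measurable G) (hGε : ∀ q, ε ≤ G q) (hGK : ∀ q, G q ≤ K) :
    Tame W fun q => G q * Real.log (G q) := by
  refine Tame.mul (Tame.of_bounded hG (C := K) fun q => ?_)
    (Tame.of_bounded (by fun_prop) (C := |Real.log ε| + |Real.log K|) fun q => ?_)
  · rw [abs_of_pos (hε.trans_le (hGε q))]; exact hGK q
  · have h1 := Real.log_le_log hε (hGε q)
    have h2 := Real.log_le_log (hε.trans_le (hGε q)) (hGK q)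
    rw [abs_le]
    constructor
    · linarith [neg_abs_le (Real.log ε), abs_nonneg (Real.log K)]
    · linarith [le_abs_self (Real.log K), abs_nonneg (Real.log ε)]

/-- One step of the entropy estimate, on the plane of increments. -/
lemma entropy_step_plane {ε K L t : ℝ} (hε : 0 < ε) (ht : 0 < t) (ht1 : t ≤ 1) (hL : 1 ≤ L)
    {G : ℝ × ℝ → ℝ} (hG : Measurable G) (hGε : ∀ q, ε ≤ G q) (hGK : ∀ q, G q ≤ K)
    {g₀ a b : ℝ} (hg : ε ≤ g₀) (ha : |a| ≤ L) (hb : |b| ≤ L)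
    (hG0 : ∀ q, |G q - g₀ - t * (q.1 * a + q.2 * b)| ≤ L * t ^ 2 * planeWeight q) :
    ∫ q, G q * Real.log (G q) ∂planeGaussian -
      (∫ q, G q ∂planeGaussian) * Real.log (∫ q, G q ∂planeGaussian) ≤
      t ^ 2 / 2 * ((a ^ 2 + b ^ 2) / g₀) +
        (3 / ε + 108 / ε ^ 2) * planeMoment 3 * (L * t) ^ 3 := by
  have hω := one_le_planeWeight
  have hg0 : 0 < g₀ := hε.trans_le hg
  have tG : Tame planeWeight G := Tame.of_bounded hG (C := K) fun q => by
    rw [abs_of_pos (hε.trans_le (hGε q))]; exact hGK q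
  have iG := tG.integrable_planeGaussian
  have iψ := (Tame.mul_log (W := planeWeight) hε hG hGε hGK).integrable_planeGaussian
  set m := ∫ q, G q ∂planeGaussian with hm
  have hm0 : 0 < m := hε.trans_le (by
    rw [hm]; simpa using integral_mono (integrable_const ε) iG hGε)
  have hpt : ∀ q, G q * Real.log (G q) - g₀ * Real.log g₀ - (Real.log g₀ + 1) * (G q - g₀) ≤
      t ^ 2 / (2 * g₀) * (a * q.1 + b * q.2) ^ 2 +
        (3 / ε + 108 / ε ^ 2) * (L * t) ^ 3 * planeWeight q ^ 3 := fun q => by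
    have hq := hω q
    refine (mul_log_sub_le hg0 (hε.trans_le (hGε q))).trans ?_
    set l := a * q.1 + b * q.2 with hl
    obtain ⟨R, hR⟩ : ∃ R, R = G q - g₀ - t * l := ⟨_, rfl⟩
    have hRb : |R| ≤ L * t ^ 2 * planeWeight q := by
      have := hG0 q
      rw [hR, hl]; convert this using 3; ring
    have hlb : |l| ≤ L * planeWeight q := by
      have h1 : |l| ≤ |a| * |q.1| + |b| * |q.2| := by
        rw [hl, ← abs_mul, ← abs_mul]; exact abs_add_le _ _
      have h2 : |q.1| + |q.2| ≤ planeWeight q := by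
        rw [planeWeight, ← sq_abs q.1, ← sq_abs q.2]
        nlinarith [sq_nonneg (|q.1| - 1), sq_nonneg (|q.2| - 1), sq_nonneg |q.1|, sq_nonneg |q.2|]
      calc |l| ≤ |a| * |q.1| + |b| * |q.2| := h1
        _ ≤ L * |q.1| + L * |q.2| := by gcongr
        _ = L * (|q.1| + |q.2|) := by ring
        _ ≤ _ := by gcongr
    have hy : G q - g₀ = t * l + R := by rw [hR]; ring
    rw [hy]
    have hLt : 0 < L * t := by positivity
    have htt : t ^ 2 ≤ t := by nlinarith
    have h3 : |t * l + R| ≤ 2 * (L * t) * planeWeight q := by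
      have h4 : |t * l| ≤ t * (L * planeWeight q) := by
        rw [abs_mul, abs_of_pos ht]; gcongr
      have h5 : L * t ^ 2 * planeWeight q ≤ L * t * planeWeight q := by gcongr
      have := abs_add_le (t * l) R
      linarith
    have h6 : (t * l + R) ^ 2 ≤ t ^ 2 * l ^ 2 + 3 * (L * t) ^ 3 * planeWeight q ^ 3 := by
      have h7 : l * R ≤ (L * planeWeight q) * (L * t ^ 2 * planeWeight q) := by
        calc l * R ≤ |l * R| := le_abs_self _
          _ = |l| * |R| := abs_mul _ _
          _ ≤ _ := by gcongr
      have h8 : R ^ 2 ≤ (L * t ^ 2 * planeWeight q) ^ 2 := by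
        rw [← sq_abs]; gcongr
      have h9 : t ^ 4 ≤ t ^ 3 := pow_le_pow_of_le_one ht.le ht1 (by norm_num)
      have h10 : (L * planeWeight q) ^ 2 ≤ L ^ 3 * planeWeight q ^ 3 := by
        rw [← mul_pow]
        exact pow_le_pow_right₀ (one_le_mul_of_one_le_of_one_le hL hq) (by norm_num)
      calc (t * l + R) ^ 2 = t ^ 2 * l ^ 2 + 2 * t * (l * R) + R ^ 2 := by ring
        _ ≤ t ^ 2 * l ^ 2 + 2 * t * ((L * planeWeight q) * (L * t ^ 2 * planeWeight q)) +
            (L * t ^ 2 * planeWeight q) ^ 2 := by gcongr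
        _ = t ^ 2 * l ^ 2 + (2 * t ^ 3 + t ^ 4) * (L * planeWeight q) ^ 2 := by ring
        _ ≤ t ^ 2 * l ^ 2 + (2 * t ^ 3 + t ^ 3) * (L ^ 3 * planeWeight q ^ 3) := by gcongr
        _ = _ := by ring
    have h11 : (t * l + R) ^ 2 / (2 * g₀) ≤ t ^ 2 / (2 * g₀) * l ^ 2 +
        3 / ε * ((L * t) ^ 3 * planeWeight q ^ 3) := by
      calc (t * l + R) ^ 2 / (2 * g₀)
          ≤ (t ^ 2 * l ^ 2 + 3 * (L * t) ^ 3 * planeWeight q ^ 3) / (2 * g₀) := by gcongr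
        _ = t ^ 2 / (2 * g₀) * l ^ 2 + 3 / (2 * g₀) * ((L * t) ^ 3 * planeWeight q ^ 3) := by
          field_simp
        _ ≤ _ := by
          gcongr
          linarith
    -- The cube of the bound 2Lt w gives 4 · 2³ = 32; the constant 108 leaves room.
    have h12 : 4 / g₀ ^ 2 * |t * l + R| ^ 3 ≤
        108 / ε ^ 2 * ((L * t) ^ 3 * planeWeight q ^ 3) := by
      calc 4 / g₀ ^ 2 * |t * l + R| ^ 3 ≤ 4 / ε ^ 2 * (2 * (L * t) * planeWeight q) ^ 3 := by
            gcongr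
        _ = 32 / ε ^ 2 * ((L * t) ^ 3 * planeWeight q ^ 3) := by ring
        _ ≤ _ := by gcongr; norm_num
    linarith
  have i1 : Integrable (fun q : ℝ × ℝ => t ^ 2 / (2 * g₀) * (a * q.1 + b * q.2) ^ 2)
      planeGaussian := ((((Tame.fst_plane.const_mul a).add hω
        (Tame.snd_plane.const_mul b)).pow 2).const_mul _).integrable_planeGaussian
  have i2 := (integrable_planeWeight_pow 3).const_mul ((3 / ε + 108 / ε ^ 2) * (L * t) ^ 3)
  have i3 : Integrable (fun q => (Real.log g₀ + 1) * (G q - g₀)) planeGaussian :=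
    (iG.sub (integrable_const g₀)).const_mul _
  have h1 := integral_mono ((iψ.sub (integrable_const (g₀ * Real.log g₀))).sub i3) (i1.add i2) hpt
  simp only [Pi.add_apply, Pi.sub_apply] at h1
  rw [integral_sub_sub iψ (integrable_const _) i3, integral_add i1 i2, integral_const_mul,
    integral_const_mul, integral_const_mul, integral_linear_sq_planeGaussian,
    integral_sub iG (integrable_const g₀)] at h1
  simp only [integral_const, probReal_univ, one_smul] at h1
  have e3 : ∫ q, (3 / ε + 108 / ε ^ 2) * (L * t) ^ 3 * planeWeight q ^ 3 ∂planeGaussian =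
      (3 / ε + 108 / ε ^ 2) * (L * t) ^ 3 * planeMoment 3 := integral_const_mul _ _
  rw [e3] at h1
  -- The expansion is made at g₀ and not at the mean m. Since m log m lies above the tangent at g₀,
  -- this can only enlarge the bound, and the linear terms cancel.
  have h2 := mul_log_sub_nonneg hg0 hm0
  have h3 : t ^ 2 / (2 * g₀) * (a ^ 2 + b ^ 2) = t ^ 2 / 2 * ((a ^ 2 + b ^ 2) / g₀) := by
    field_simp
  rw [h3] at h1
  have h4 : (3 / ε + 108 / ε ^ 2) * (L * t) ^ 3 * planeMoment 3 =
    (3 / ε + 108 / ε ^ 2) * planeMoment 3 * (L * t) ^ 3 := by ring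
  rw [h4] at h1
  linarith

/-! ### Summation along the random walk -/

/-- The left-invariant energy `(𝖷 f)² + (𝖸 f)² + ν (𝖹 f)²`. -/
noncomputable def leftEnergy (ν : ℝ) (f : HeisenbergSpace → ℝ) (p : HeisenbergSpace) : ℝ :=
  (partialX f p - p.2.1 / 2 * partialZ f p) ^ 2 + (partialY f p + p.1 / 2 * partialZ f p) ^ 2 +
    ν * partialZ f p ^ 2

/-- The energy of the average of `g` along the walk, relative to that average. -/
noncomputable def walkEnergy (ν : ℝ) (g : HeisenbergSpace → ℝ) (t : ℝ) (j : ℕ)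
    (p : HeisenbergSpace) : ℝ :=
  (walkX g t j p ^ 2 + walkY g t j p ^ 2 + ν * walkZ g t j p ^ 2) / walkMean g t j p

namespace IsUniformlyRegular

variable {g : HeisenbergSpace → ℝ} {ε K : ℝ}

lemma tame_walkMean (hg : IsUniformlyRegular g ε K) (t : ℝ) (j : ℕ) :
    Tame heisenbergWeight (walkMean g t j) :=
  Tame.of_bounded (hg.measurable_walkMean t j) (C := K) fun p => by
    rw [abs_of_pos (hg.pos.trans_le (hg.le_walkMean t j p))]; exact hg.walkMean_le t j p

lemma tame_walkX (hg : IsUniformlyRegular g ε K) {t : ℝ} {j : ℕ} (h : j * t ^ 2 ≤ 1) :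
    Tame heisenbergWeight (walkX g t j) :=
  ⟨hg.measurable_walkX t j, 2 * K * weightMoment 1, 1,
    by have := hg.K_pos; have := weightMoment_nonneg 1; positivity,
    fun p => by simpa using hg.abs_walkX_le h p⟩

lemma tame_walkY (hg : IsUniformlyRegular g ε K) {t : ℝ} {j : ℕ} (h : j * t ^ 2 ≤ 1) :
    Tame heisenbergWeight (walkY g t j) :=
  ⟨hg.measurable_walkY t j, 2 * K * weightMoment 1, 1,
    by have := hg.K_pos; have := weightMoment_nonneg 1; positivity,
    fun p => by simpa using hg.abs_walkY_le h p⟩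

lemma tame_walkZ (hg : IsUniformlyRegular g ε K) {t : ℝ} {j : ℕ} (h : j * t ^ 2 ≤ 1) :
    Tame heisenbergWeight (walkZ g t j) :=
  ⟨hg.measurable_walkZ t j, 2 * K * weightMoment 1, 1,
    by have := hg.K_pos; have := weightMoment_nonneg 1; positivity,
    fun p => by simpa using hg.abs_walkZ_le h p⟩

lemma tame_walkEnergy (hg : IsUniformlyRegular g ε K) (ν : ℝ) {t : ℝ} {j : ℕ}
    (h : j * t ^ 2 ≤ 1) : Tame heisenbergWeight (walkEnergy ν g t j) := by
  have h1 := one_le_heisenbergWeight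
  refine Tame.mul ((((hg.tame_walkX h).pow 2).add h1 ((hg.tame_walkY h).pow 2)).add h1
    (((hg.tame_walkZ h).pow 2).const_mul ν)) ?_
  refine Tame.of_bounded (hg.measurable_walkMean t j).inv (C := ε⁻¹) fun p => ?_
  rw [abs_of_pos (inv_pos.2 (hg.pos.trans_le (hg.le_walkMean t j p)))]
  exact inv_anti₀ hg.pos (hg.le_walkMean t j p)

/-- The constant controlling first-order quantities at the position `p`. -/
noncomputable def lipConst (K : ℝ) : ℝ := 4 * K * weightMoment 1 + K + 1

lemma walkEnergy_le (hg : IsUniformlyRegular g ε K) {ν : ℝ} (hν : 0 < ν) {t : ℝ} {j : ℕ}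
    (h : j * t ^ 2 ≤ 1) (p : HeisenbergSpace) :
    walkEnergy ν g t j p ≤ (2 + ν) * lipConst K ^ 2 / ε * heisenbergWeight p ^ 2 := by
  have hK := hg.K_pos
  have hε := hg.pos
  have hM := weightMoment_nonneg 1
  have hp := one_le_heisenbergWeight p
  have hC : 2 * K * weightMoment 1 * heisenbergWeight p ≤ lipConst K * heisenbergWeight p := by
    have : 0 ≤ K * weightMoment 1 := by positivity
    unfold lipConst
    gcongr
    linarith
  have sqle : ∀ x : ℝ, |x| ≤ 2 * K * weightMoment 1 * heisenbergWeight p →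
      x ^ 2 ≤ (lipConst K * heisenbergWeight p) ^ 2 := fun x hx => by
    rw [← sq_abs]; exact pow_le_pow_left₀ (abs_nonneg _) (hx.trans hC) 2
  have hx := sqle _ (hg.abs_walkX_le h p)
  have hy := sqle _ (hg.abs_walkY_le h p)
  have hz := sqle _ (hg.abs_walkZ_le h p)
  calc walkEnergy ν g t j p ≤ (walkX g t j p ^ 2 + walkY g t j p ^ 2 + ν * walkZ g t j p ^ 2) / ε :=
        div_le_div_of_nonneg_left (by positivity) hε (hg.le_walkMean t j p)
    _ ≤ ((lipConst K * heisenbergWeight p) ^ 2 + (lipConst K * heisenbergWeight p) ^ 2 +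
          ν * (lipConst K * heisenbergWeight p) ^ 2) / ε := by gcongr
    _ = _ := by ring

lemma walkEnergy_nonneg (hg : IsUniformlyRegular g ε K) {ν : ℝ} (hν : 0 < ν) (t : ℝ) (j : ℕ)
    (p : HeisenbergSpace) : 0 ≤ walkEnergy ν g t j p :=
  div_nonneg (by positivity) (hg.pos.le.trans (hg.le_walkMean t j p))

/-- The pointwise gradient estimate for one step of the walk. -/
lemma walkEnergy_succ_le (hg : IsUniformlyRegular g ε K) {ν : ℝ} (hν : 0 < ν) :
    ∃ C, 0 ≤ C ∧ ∀ {t : ℝ} {j : ℕ}, 0 < t → t ≤ 1 → j * t ^ 2 ≤ 1 → ∀ p,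
      walkEnergy ν g t (j + 1) p ≤ (1 + t ^ 2 / ν) *
        ∫ q, walkEnergy ν g t j (heisenbergMul p (horizontal t q)) ∂planeGaussian +
          C * t ^ 3 * heisenbergWeight p ^ 3 := by
  have hK := hg.K_pos
  have hε := hg.pos
  have hM := weightMoment_nonneg 1
  have hM1 := one_le_planeMoment 1
  have hM2 := one_le_planeMoment 2
  have hL0 : 0 < lipConst K := by unfold lipConst; positivity
  set D := 4 * planeMoment 1 * planeMoment 2 * (1 + 1 / ν) / (ε * ν) with hD
  have hD0 : 0 ≤ D := by positivity
  refine ⟨D * lipConst K * ((2 + ν) * lipConst K ^ 2 / ε * 4 * planeMoment 2), by positivity,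
    fun {t j} ht ht1 h p => ?_⟩
  have hp := one_le_heisenbergWeight p
  have ht2 : t ^ 2 ≤ 1 := pow_le_one₀ ht.le ht1
  have step := gradient_step_plane (L := lipConst K * heisenbergWeight p) hν hε ht ht1 (by
      have : K ≤ lipConst K := by unfold lipConst; nlinarith [mul_nonneg hK.le hM]
      nlinarith)
    ((hg.tame_walkMean t j).comp_step ht2 p) ((hg.tame_walkX h).comp_step ht2 p)
    ((hg.tame_walkY h).comp_step ht2 p) ((hg.tame_walkZ h).comp_step ht2 p)
    (fun q => hg.le_walkMean t j _) (fun q => hg.walkMean_le t j _) (g₀ := walkMean g t j p)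
    (fun q => ?_) (hg.integral_rotation ht.ne' j p) (hg.walkX_succ t j p) (hg.walkY_succ t j p)
    (hg.walkZ_succ t j p) (hg.walkMean_succ t j p)
  -- The error in the gradient step is relative, of size t³ times the weight of p. The crude bound
  -- of the energy by the squared weight makes it additive, with the third power of the weight.
  · have hI : ∫ q, walkEnergy ν g t j (heisenbergMul p (horizontal t q)) ∂planeGaussian ≤
        (2 + ν) * lipConst K ^ 2 / ε * 4 * planeMoment 2 * heisenbergWeight p ^ 2 := by
      have h1 : ∀ q, walkEnergy ν g t j (heisenbergMul p (horizontal t q)) ≤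
          (2 + ν) * lipConst K ^ 2 / ε * 4 * heisenbergWeight p ^ 2 * planeWeight q ^ 2 :=
        fun q => by
          have h2 := one_le_heisenbergWeight (heisenbergMul p (horizontal t q))
          calc _ ≤ (2 + ν) * lipConst K ^ 2 / ε *
                heisenbergWeight (heisenbergMul p (horizontal t q)) ^ 2 := hg.walkEnergy_le hν h _
            _ ≤ (2 + ν) * lipConst K ^ 2 / ε * (2 * heisenbergWeight p * planeWeight q) ^ 2 := by
              gcongr
              exact heisenbergWeight_mul_horizontal_le ht2 p q
            _ = _ := by ring
      have h3 := integral_mono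
        ((hg.tame_walkEnergy ν h).comp_step ht2 p).integrable_planeGaussian
        ((integrable_planeWeight_pow 2).const_mul
          ((2 + ν) * lipConst K ^ 2 / ε * 4 * heisenbergWeight p ^ 2)) h1
      rw [integral_const_mul] at h3
      refine h3.trans_eq ?_
      unfold planeMoment
      ring
    refine step.trans ?_
    change (1 + t ^ 2 / ν + D * (lipConst K * heisenbergWeight p) * t ^ 3) *
      ∫ q, walkEnergy ν g t j (heisenbergMul p (horizontal t q)) ∂planeGaussian ≤ _
    rw [add_mul (1 + t ^ 2 / ν)]
    refine add_le_add_right ?_ _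
    calc _ ≤ D * (lipConst K * heisenbergWeight p) * t ^ 3 *
          ((2 + ν) * lipConst K ^ 2 / ε * 4 * planeMoment 2 * heisenbergWeight p ^ 2) := by gcongr
      _ = _ := by ring
  · have hq := one_le_planeWeight q
    have h1 := hg.abs_walkMean_sub_le h p q
    have hx := hg.abs_walkX_le h p
    have hy := hg.abs_walkY_le h p
    set c := 2 * K * weightMoment 1 * heisenbergWeight p with hc
    have hc0 : 0 ≤ c := by positivity
    have h2 : |q.1| + |q.2| ≤ planeWeight q := by
      rw [planeWeight, ← sq_abs q.1, ← sq_abs q.2]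
      nlinarith [sq_nonneg (|q.1| - 1), sq_nonneg (|q.2| - 1), sq_nonneg |q.1|, sq_nonneg |q.2|]
    have h3 : |t * (q.1 * walkX g t j p + q.2 * walkY g t j p)| ≤ t * (c * planeWeight q) := by
      rw [abs_mul, abs_of_pos ht]
      refine mul_le_mul_of_nonneg_left ?_ ht.le
      calc _ ≤ |q.1| * |walkX g t j p| + |q.2| * |walkY g t j p| := by
            rw [← abs_mul, ← abs_mul]; exact abs_add_le _ _
        _ ≤ |q.1| * c + |q.2| * c := by gcongr
        _ = c * (|q.1| + |q.2|) := by ring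
        _ ≤ _ := by gcongr
    have h4 : 2 * K * weightMoment 1 * t ^ 2 * heisenbergWeight p * planeWeight q ≤
        t * (c * planeWeight q) := by
      have htt : t ^ 2 ≤ t := by nlinarith
      calc _ = t ^ 2 * (c * planeWeight q) := by rw [hc]; ring
        _ ≤ _ := by gcongr
    -- The first-order term and the Taylor remainder contribute c each; this is the origin of the 4
    -- in `lipConst`.
    have h5 : 2 * c ≤ lipConst K * heisenbergWeight p := by
      rw [hc]; unfold lipConst; nlinarith
    have h6 := abs_add_le (walkMean g t j (heisenbergMul p (horizontal t q)) - walkMean g t j p -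
      t * (q.1 * walkX g t j p + q.2 * walkY g t j p))
      (t * (q.1 * walkX g t j p + q.2 * walkY g t j p))
    rw [sub_add_cancel] at h6
    calc _ ≤ t * (c * planeWeight q) + t * (c * planeWeight q) := by linarith
      _ = (2 * c) * t * planeWeight q := by ring
      _ ≤ _ := by gcongr

/-- The pointwise entropy estimate for one step of the walk. -/
lemma entropy_succ_le (hg : IsUniformlyRegular g ε K) {ν : ℝ} (hν : 0 < ν) :
    ∃ C, 0 ≤ C ∧ ∀ {t : ℝ} {j : ℕ}, 0 < t → t ≤ 1 → j * t ^ 2 ≤ 1 → ∀ p,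
      ∫ q, walkMean g t j (heisenbergMul p (horizontal t q)) *
        Real.log (walkMean g t j (heisenbergMul p (horizontal t q))) ∂planeGaussian ≤
      walkMean g t (j + 1) p * Real.log (walkMean g t (j + 1) p) +
        t ^ 2 / 2 * walkEnergy ν g t j p + C * t ^ 3 * heisenbergWeight p ^ 3 := by
  have hK := hg.K_pos
  have hε := hg.pos
  have hM := weightMoment_nonneg 1
  have hM3 := one_le_planeMoment 3
  have hL0 : 0 < lipConst K := by unfold lipConst; positivity
  refine ⟨(3 / ε + 108 / ε ^ 2) * planeMoment 3 * lipConst K ^ 3, by positivity,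
    fun {t j} ht ht1 h p => ?_⟩
  have hp := one_le_heisenbergWeight p
  have hC : 2 * K * weightMoment 1 * heisenbergWeight p ≤ lipConst K * heisenbergWeight p := by
    have : 0 ≤ K * weightMoment 1 := by positivity
    unfold lipConst
    gcongr
    linarith
  have h1L : 1 ≤ lipConst K * heisenbergWeight p := by
    have : 1 ≤ lipConst K := by unfold lipConst; nlinarith [mul_nonneg hK.le hM]
    exact one_le_mul_of_one_le_of_one_le this hp
  have hmeas := hg.measurable_walkMean t j
  have step := entropy_step_plane (L := lipConst K * heisenbergWeight p) hε ht ht1 h1L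
    (G := fun q => walkMean g t j (heisenbergMul p (horizontal t q))) (by fun_prop)
    (fun q => hg.le_walkMean t j _) (fun q => hg.walkMean_le t j _) (hg.le_walkMean t j p)
    ((hg.abs_walkX_le h p).trans hC) ((hg.abs_walkY_le h p).trans hC) (fun q => by
      have hq := one_le_planeWeight q
      refine (hg.abs_walkMean_sub_le h p q).trans ?_
      calc _ = (2 * K * weightMoment 1 * heisenbergWeight p) * t ^ 2 * planeWeight q := by ring
        _ ≤ _ := by gcongr)
  rw [← hg.walkMean_succ t j p] at step
  have hm := hε.trans_le (hg.le_walkMean t j p)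
  -- A horizontal step sees only the X- and Y-derivatives; νZ² is added for free because the
  -- gradient bound needs it.
  have hle : (walkX g t j p ^ 2 + walkY g t j p ^ 2) / walkMean g t j p ≤ walkEnergy ν g t j p := by
    have : 0 ≤ ν * walkZ g t j p ^ 2 := by positivity
    exact div_le_div_of_nonneg_right (by linarith) hm.le
  have h2 := mul_le_mul_of_nonneg_left hle (by positivity : 0 ≤ t ^ 2 / 2)
  have h3 : (3 / ε + 108 / ε ^ 2) * planeMoment 3 * (lipConst K * heisenbergWeight p * t) ^ 3 =
    (3 / ε + 108 / ε ^ 2) * planeMoment 3 * lipConst K ^ 3 * t ^ 3 * heisenbergWeight p ^ 3 := by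
    ring
  linarith

lemma integrable_step {φ : HeisenbergSpace → ℝ} (hφ : Tame heisenbergWeight φ) (t : ℝ) (k : ℕ) :
    Integrable (fun p => ∫ q, φ (heisenbergMul p (horizontal t q)) ∂planeGaussian)
      (walkLaw t k) := by
  have h := hφ.integrable_walkLaw t (k + 1)
  rw [walkLaw_succ'] at h
  exact ((integrable_map_measure h.aestronglyMeasurable (by fun_prop)).1 h).integral_prod_left

/-- Each use of the one-step bound removes one averaging from g and adds one step to the walk, so j
+ k is preserved. The errors are integrable with uniform moments and pick up at most the full factor
(1 + t²/ν)^j. -/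
lemma integral_walkEnergy_le (hg : IsUniformlyRegular g ε K) {ν : ℝ} (hν : 0 < ν) :
    ∃ C, 0 ≤ C ∧ ∀ {t : ℝ}, 0 < t → t ≤ 1 → ∀ {j k : ℕ}, (j + k) * t ^ 2 ≤ 1 →
      ∫ p, walkEnergy ν g t j p ∂walkLaw t k ≤ (1 + t ^ 2 / ν) ^ j *
        (∫ p, walkEnergy ν g t 0 p ∂walkLaw t (j + k) + j * (C * t ^ 3)) := by
  obtain ⟨C, hC, hstep⟩ := hg.walkEnergy_succ_le hν
  have hW := weightMoment_nonneg 3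
  refine ⟨C * weightMoment 3, by positivity, fun {t} ht ht1 j => ?_⟩
  induction j with
  | zero => intro k _; simp
  | succ j ih =>
    intro k hjk
    have ht0 : 0 ≤ t ^ 2 := sq_nonneg t
    have hj0 : (0 : ℝ) ≤ j := j.cast_nonneg
    have hk0 : (0 : ℝ) ≤ k := k.cast_nonneg
    push_cast at hjk
    have hj : (j : ℝ) * t ^ 2 ≤ 1 := by nlinarith
    have hj1 : ((j + 1 : ℕ) : ℝ) * t ^ 2 ≤ 1 := by push_cast; nlinarith
    have hk : (k : ℝ) * t ^ 2 ≤ 1 := by nlinarith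
    have hE := hg.tame_walkEnergy ν hj
    have i1 := (integrable_step hE t k).const_mul (1 + t ^ 2 / ν)
    have i2 := (integrable_heisenbergWeight_pow t k 3).const_mul (C * t ^ 3)
    have h1 := integral_mono ((hg.tame_walkEnergy ν hj1).integrable_walkLaw t k) (i1.add i2)
      (hstep ht ht1 hj)
    simp only [Pi.add_apply] at h1
    rw [integral_add i1 i2, integral_const_mul, integral_const_mul,
      ← integral_walkLaw_succ' (hE.integrable_walkLaw t (k + 1))] at h1
    have h2 := ih (k := k + 1) (by push_cast; linarith)
    have h3 : C * t ^ 3 * ∫ p, heisenbergWeight p ^ 3 ∂walkLaw t k ≤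
        C * weightMoment 3 * t ^ 3 := by
      have := mul_le_mul_of_nonneg_left (integral_heisenbergWeight_pow_le hk 3)
        (by positivity : 0 ≤ C * t ^ 3)
      linarith
    have h4 : 1 ≤ (1 + t ^ 2 / ν) ^ (j + 1) :=
      one_le_pow₀ (by linarith [div_nonneg ht0 hν.le])
    have h5 : C * weightMoment 3 * t ^ 3 ≤
        (1 + t ^ 2 / ν) ^ (j + 1) * (C * weightMoment 3 * t ^ 3) :=
      le_mul_of_one_le_left (by positivity) h4
    have e : j + 1 + k = j + (k + 1) := by ring
    rw [e]
    calc _ ≤ (1 + t ^ 2 / ν) * ((1 + t ^ 2 / ν) ^ j *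
          (∫ p, walkEnergy ν g t 0 p ∂walkLaw t (j + (k + 1)) +
            j * (C * weightMoment 3 * t ^ 3))) + C * weightMoment 3 * t ^ 3 := by
          refine h1.trans (add_le_add (mul_le_mul_of_nonneg_left h2 ?_) h3)
          positivity
      _ ≤ (1 + t ^ 2 / ν) * ((1 + t ^ 2 / ν) ^ j *
          (∫ p, walkEnergy ν g t 0 p ∂walkLaw t (j + (k + 1)) +
            j * (C * weightMoment 3 * t ^ 3))) +
            (1 + t ^ 2 / ν) ^ (j + 1) * (C * weightMoment 3 * t ^ 3) := by gcongr
      _ = _ := by push_cast; ring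

/-- The logarithmic Sobolev inequality for the random walk, up to an error that vanishes as the
number of steps grows. -/
theorem entropy_walkLaw_le (hg : IsUniformlyRegular g ε K) {ν : ℝ} (hν : 0 < ν) :
    ∃ C, ∀ {t : ℝ} {n : ℕ}, 0 < t → (n + 1 : ℝ) * t ^ 2 = 1 →
      entropy (walkLaw t (n + 1)) g ≤ ν / 2 * (Real.exp (1 / ν) - 1) *
        ∫ p, leftEnergy ν g p / g p ∂walkLaw t n + C * t := by
  obtain ⟨C, hC, hgrad⟩ := hg.integral_walkEnergy_le hν
  obtain ⟨C', hC', hent⟩ := hg.entropy_succ_le hν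
  have hW := weightMoment_nonneg 3
  refine ⟨ν / 2 * (Real.exp (1 / ν) - 1) * C + C' * weightMoment 3, fun {t n} ht hn => ?_⟩
  have hn0 : (0 : ℝ) ≤ n := n.cast_nonneg
  have ht0 : 0 ≤ t ^ 2 := sq_nonneg t
  have ht1 : t ≤ 1 := by
    by_contra hcon
    push Not at hcon
    nlinarith
  have hT : ∫ p, leftEnergy ν g p / g p ∂walkLaw t n = ∫ p, walkEnergy ν g t 0 p ∂walkLaw t n := by
    refine integral_congr_ae (ae_of_all _ fun p => ?_)
    simp only [walkEnergy, leftEnergy, hg.walkX_zero, hg.walkY_zero, hg.walkZ_zero,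
      hg.walkMean_zero]
  rw [hT]
  set T := ∫ p, walkEnergy ν g t 0 p ∂walkLaw t n with hTdef
  have hT0 : 0 ≤ T := integral_nonneg fun p => hg.walkEnergy_nonneg hν t 0 p
  have tψ : ∀ j, Tame heisenbergWeight fun p => walkMean g t j p * Real.log (walkMean g t j p) :=
    fun j => Tame.mul_log hg.pos (hg.measurable_walkMean t j) (hg.le_walkMean t j)
      (hg.walkMean_le t j)
  -- Discrete interpolation: i of the n + 1 steps have been averaged into g, and the walk is stopped
  -- after the other k.
  have key : ∀ i k : ℕ, i + k = n + 1 →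
      ∫ p, g p * Real.log (g p) ∂walkLaw t (n + 1) ≤
        ∫ p, walkMean g t i p * Real.log (walkMean g t i p) ∂walkLaw t k +
          ν / 2 * ((1 + t ^ 2 / ν) ^ i - 1) * (T + C * t) +
            i * (C' * weightMoment 3 * t ^ 3) := by
    intro i
    induction i with
    | zero =>
      intro k hk
      rw [zero_add] at hk
      simp [hk, hg.walkMean_zero]
    | succ i ih =>
      intro k hk
      have hik : (i : ℝ) + k = n := by
        have : i + k = n := by omega
        exact_mod_cast this
      have hk0 : (0 : ℝ) ≤ k := k.cast_nonneg
      have hi0 : (0 : ℝ) ≤ i := i.cast_nonneg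
      have hi : (i : ℝ) * t ^ 2 ≤ 1 := by nlinarith
      have hkt : (k : ℝ) * t ^ 2 ≤ 1 := by nlinarith
      have h1 := ih (k + 1) (by omega)
      have i0 := (tψ (i + 1)).integrable_walkLaw t k
      have i1 := ((hg.tame_walkEnergy ν hi).integrable_walkLaw t k).const_mul (t ^ 2 / 2)
      have i2 := (integrable_heisenbergWeight_pow t k 3).const_mul (C' * t ^ 3)
      have h2 := integral_mono (integrable_step (tψ i) t k) ((i0.add i1).add i2) (hent ht ht1 hi)
      have h3 := integral_add (i0.add i1) i2
      have h4 := integral_add i0 i1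
      simp only [Pi.add_apply] at h2 h3
      rw [h3, h4, integral_const_mul, integral_const_mul,
        ← integral_walkLaw_succ' ((tψ i).integrable_walkLaw t (k + 1))] at h2
      have h5 : C' * t ^ 3 * ∫ p, heisenbergWeight p ^ 3 ∂walkLaw t k ≤
          C' * weightMoment 3 * t ^ 3 := by
        have := mul_le_mul_of_nonneg_left (integral_heisenbergWeight_pow_le hkt 3)
          (by positivity : 0 ≤ C' * t ^ 3)
        linarith
      -- The step from i to i + 1 involves the energy at i averagings and walk length k, so i + k =
      -- n: the final energy is taken under the law after n steps, although the entropy is taken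
      -- after n + 1.
      have h6 := hgrad ht ht1 (j := i) (k := k) (by rw [hik]; nlinarith)
      have h7 : i + k = n := by omega
      rw [h7, ← hTdef] at h6
      have h8 : (i : ℝ) * (C * t ^ 3) ≤ C * t := by
        have := mul_le_mul_of_nonneg_right hi (by positivity : 0 ≤ C * t)
        calc (i : ℝ) * (C * t ^ 3) = i * t ^ 2 * (C * t) := by ring
          _ ≤ _ := by linarith
      have h9 : t ^ 2 / 2 * ∫ p, walkEnergy ν g t i p ∂walkLaw t k ≤
          t ^ 2 / 2 * ((1 + t ^ 2 / ν) ^ i * (T + C * t)) := by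
        refine mul_le_mul_of_nonneg_left (h6.trans ?_) (by positivity)
        gcongr
      -- The geometric series of ratio 1 + t²/ν with terms weighted by t²/2: consecutive partial
      -- sums differ by (t²/2)(1 + t²/ν)^i.
      have e : ν / 2 * ((1 + t ^ 2 / ν) ^ (i + 1) - 1) * (T + C * t) =
          ν / 2 * ((1 + t ^ 2 / ν) ^ i - 1) * (T + C * t) +
            t ^ 2 / 2 * ((1 + t ^ 2 / ν) ^ i * (T + C * t)) := by
        have h10 : ν * (t ^ 2 / ν) = t ^ 2 := mul_div_cancel₀ _ hν.ne'
        linear_combination (1 + t ^ 2 / ν) ^ i * (T + C * t) / 2 * h10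
      rw [e]
      push_cast
      linarith
  have hfin := key (n + 1) 0 rfl
  have hmeas := hg.measurable_walkMean t (n + 1)
  -- After all steps are averaged, the walk sits at the identity and the integral has become
  -- Φ(E[g]), the second term of the entropy.
  have hend : ∫ p, walkMean g t (n + 1) p * Real.log (walkMean g t (n + 1) p) ∂walkLaw t 0 =
      (∫ p, g p ∂walkLaw t (n + 1)) * Real.log (∫ p, g p ∂walkLaw t (n + 1)) := by
    rw [walkLaw, integral_dirac' _ _ (Measurable.stronglyMeasurable (by fun_prop))]
    simp only [walkMean, zero_heisenbergMul]
  rw [hend] at hfin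
  have hexp : (1 + t ^ 2 / ν) ^ (n + 1) ≤ Real.exp (1 / ν) := by
    have h1 : 1 + t ^ 2 / ν ≤ Real.exp (t ^ 2 / ν) := by
      linarith [Real.add_one_le_exp (t ^ 2 / ν)]
    calc _ ≤ Real.exp (t ^ 2 / ν) ^ (n + 1) := by gcongr
      _ = Real.exp (1 / ν) := by
        rw [← Real.exp_nat_mul]
        congr 1
        push_cast
        rw [← mul_div_assoc, hn]
  have h10 : ν / 2 * ((1 + t ^ 2 / ν) ^ (n + 1) - 1) * (T + C * t) ≤
      ν / 2 * (Real.exp (1 / ν) - 1) * (T + C * t) := by gcongr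
  have h11 : ((n + 1 : ℕ) : ℝ) * (C' * weightMoment 3 * t ^ 3) = C' * weightMoment 3 * t := by
    push_cast
    calc _ = (n + 1 : ℝ) * t ^ 2 * (C' * weightMoment 3 * t) := by ring
      _ = _ := by rw [hn, one_mul]
  rw [h11] at hfin
  unfold entropy
  linarith

end IsUniformlyRegular

/-! ### Discretization of planar Brownian motion and its Lévy area -/

section Brownian

variable {Ω : Type*}

/-- The piecewise horizontal approximation of the Heisenberg Brownian motion along the arithmetic
progression of times `k h`. -/
noncomputable def discretePath (X Y : ℝ≥0 → Ω → ℝ) (h : ℝ≥0) (k : ℕ) (ω : Ω) : HeisenbergSpace :=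
  (X (k * h) ω, Y (k * h) ω,
    (1 / 2) * (∑ i ∈ Finset.range k, X (i * h) ω * (Y ((i + 1 : ℕ) * h) ω - Y (i * h) ω) -
      ∑ i ∈ Finset.range k, Y (i * h) ω * (X ((i + 1 : ℕ) * h) ω - X (i * h) ω)))

lemma discretePath_succ (X Y : ℝ≥0 → Ω → ℝ) (h : ℝ≥0) (k : ℕ) (ω : Ω) :
    discretePath X Y h (k + 1) ω = heisenbergMul (discretePath X Y h k ω)
      (X ((k + 1 : ℕ) * h) ω - X (k * h) ω, Y ((k + 1 : ℕ) * h) ω - Y (k * h) ω, 0) := by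
  simp only [discretePath, heisenbergMul, Finset.sum_range_succ, Prod.mk.injEq]
  refine ⟨by ring, by ring, by ring⟩

variable [MeasurableSpace Ω] {P : Measure Ω}

/-- Regroups the two independent motions, each split into past and increment, into a joint past and
a joint increment. -/
lemma map_prod_prod_comm {α β γ δ : Type*} [MeasurableSpace α] [MeasurableSpace β]
    [MeasurableSpace γ] [MeasurableSpace δ] (a : Measure α) (b : Measure β) (c : Measure γ)
    (d : Measure δ) [SFinite a] [SFinite b] [SFinite c] [SFinite d] :
    ((a.prod b).prod (c.prod d)).map (fun z => ((z.1.1, z.2.1), (z.1.2, z.2.2))) =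
      (a.prod c).prod (b.prod d) := by
  refine Measure.ext_of_lintegral _ fun f hf => ?_
  rw [lintegral_map hf (by fun_prop), lintegral_prod _ (by fun_prop),
    lintegral_prod _ (by fun_prop), lintegral_prod _ (by fun_prop), lintegral_prod _ (by fun_prop)]
  refine lintegral_congr fun x => ?_
  have h : ∀ y, ∫⁻ z : γ × δ, f ((x, z.1), (y, z.2)) ∂c.prod d =
      ∫⁻ u, ∫⁻ v, f ((x, u), (y, v)) ∂d ∂c := fun y => lintegral_prod _ (by fun_prop)
  have h' : ∀ u, ∫⁻ z : β × δ, f ((x, u), z) ∂b.prod d =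
      ∫⁻ y, ∫⁻ v, f ((x, u), (y, v)) ∂d ∂b := fun u => lintegral_prod _ (by fun_prop)
  simp_rw [h, h']
  refine lintegral_lintegral_swap (Measurable.aemeasurable ?_)
  exact Measurable.lintegral_prod_right' (f := fun z : (β × γ) × δ => f ((x, z.1.2), (z.1.1, z.2)))
    (by fun_prop)

/-- If `(U, D)` is independent of `(V, E)`, `U` of `D` and `V` of `E`, then `(U, V)` is independent
of `(D, E)`. -/
lemma IndepFun.prod_regroup [IsProbabilityMeasure P] {α β γ δ : Type*} [MeasurableSpace α]
    [MeasurableSpace β] [MeasurableSpace γ] [MeasurableSpace δ] {U : Ω → α} {D : Ω → β} {V : Ω → γ}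
    {E : Ω → δ} (hU : AEMeasurable U P) (hD : AEMeasurable D P) (hV : AEMeasurable V P)
    (hE : AEMeasurable E P) (h : IndepFun (fun ω => (U ω, D ω)) (fun ω => (V ω, E ω)) P)
    (hUD : IndepFun U D P) (hVE : IndepFun V E P) :
    IndepFun (fun ω => (U ω, V ω)) (fun ω => (D ω, E ω)) P := by
  have := Measure.isProbabilityMeasure_map hU
  have := Measure.isProbabilityMeasure_map hV
  have := Measure.isProbabilityMeasure_map hD
  have := Measure.isProbabilityMeasure_map hE
  have hUV : IndepFun U V P := h.comp measurable_fst measurable_fst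
  have hDE : IndepFun D E P := h.comp measurable_snd measurable_snd
  rw [indepFun_iff_map_prod_eq_prod_map_map (by fun_prop) (by fun_prop)] at h hUD hVE hUV hDE ⊢
  rw [hUV, hDE, ← map_prod_prod_comm, ← hUD, ← hVE, ← h,
    AEMeasurable.map_map_of_aemeasurable (by fun_prop) (by fun_prop)]
  rfl

/-- The shifted process after time k h is independent of the path up to k h. The whole sampled past
is retained, not just the current value, because the discrete area depends on it. -/
lemma indepFun_past_increment {X : ℝ≥0 → Ω → ℝ} (hX : IsPreBrownianReal X P) (h : ℝ≥0) (k : ℕ) :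
    IndepFun (fun ω (i : Fin (k + 1)) => X (((i : ℕ) : ℝ≥0) * h) ω)
      (fun ω => X ((k + 1 : ℕ) * h) ω - X (k * h) ω) P := by
  have := (hX.indepFun_shift (k * h)).symm
  have hm : ∀ i : Fin (k + 1), ((i : ℕ) : ℝ≥0) * h ∈ Set.Iic ((k : ℝ≥0) * h) := fun i => by
    have : ((i : ℕ) : ℝ≥0) ≤ k := by exact_mod_cast Nat.lt_succ_iff.1 i.2
    exact mul_le_mul_left this h
  have hψ : Measurable fun u : ℝ≥0 → ℝ => u h := measurable_pi_apply h
  have h2 := this.comp (φ := fun u (i : Fin (k + 1)) => u ⟨((i : ℕ) : ℝ≥0) * h, hm i⟩)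
    (ψ := fun u : ℝ≥0 → ℝ => u h) (measurable_pi_lambda _ fun i => measurable_pi_apply _)
    hψ
  have e : (k : ℝ≥0) * h + h = ((k + 1 : ℕ) : ℝ≥0) * h := by push_cast; ring
  simpa [Function.comp_def, e] using h2

lemma hasLaw_increment {X : ℝ≥0 → Ω → ℝ} (hX : IsPreBrownianReal X P) (h : ℝ≥0) (k : ℕ) :
    HasLaw (fun ω => X ((k + 1 : ℕ) * h) ω - X (k * h) ω) (gaussianReal 0 h) P := by
  have := (hX.shift (k * h)).hasLaw_eval h
  have e : (k : ℝ≥0) * h + h = ((k + 1 : ℕ) : ℝ≥0) * h := by push_cast; ring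
  simpa only [e] using this

/-- The discretized path is a horizontal Gaussian random walk. -/
lemma hasLaw_discretePath [IsProbabilityMeasure P] {X Y : ℝ≥0 → Ω → ℝ}
    (hX : IsPreBrownianReal X P) (hY : IsPreBrownianReal Y P)
    (hXY : IndepFun (fun ω t => X t ω) (fun ω t => Y t ω) P) (h : ℝ≥0) (k : ℕ) :
    HasLaw (discretePath X Y h k) (walkLaw (√(h : ℝ)) k) P := by
  induction k with
  | zero =>
    refine hasLaw_dirac_of_ae_eq ?_
    filter_upwards [hX.eval_zero_ae_eq_zero, hY.eval_zero_ae_eq_zero] with ω h1 h2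
    simp [discretePath, h1, h2]
  | succ k ih =>
    have mX := hX.aemeasurable
    have mY := hY.aemeasurable
    set U : Ω → Fin (k + 1) → ℝ := fun ω i => X (((i : ℕ) : ℝ≥0) * h) ω with hU
    set V : Ω → Fin (k + 1) → ℝ := fun ω i => Y (((i : ℕ) : ℝ≥0) * h) ω with hV
    set D : Ω → ℝ := fun ω => X ((k + 1 : ℕ) * h) ω - X (k * h) ω with hD
    set E : Ω → ℝ := fun ω => Y ((k + 1 : ℕ) * h) ω - Y (k * h) ω with hE
    have lD : HasLaw D (gaussianReal 0 h) P := hasLaw_increment hX h k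
    have lE : HasLaw E (gaussianReal 0 h) P := hasLaw_increment hY h k
    have hpair : IndepFun (fun ω => (U ω, D ω)) (fun ω => (V ω, E ω)) P :=
      hXY.comp (φ := fun x : ℝ≥0 → ℝ => ((fun i : Fin (k + 1) => x (((i : ℕ) : ℝ≥0) * h)),
          x ((k + 1 : ℕ) * h) - x (k * h)))
        (ψ := fun x : ℝ≥0 → ℝ => ((fun i : Fin (k + 1) => x (((i : ℕ) : ℝ≥0) * h)),
          x ((k + 1 : ℕ) * h) - x (k * h))) (by fun_prop) (by fun_prop)
    have hind := IndepFun.prod_regroup (aemeasurable_pi_lambda _ fun i => mX _) lD.aemeasurable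
      (aemeasurable_pi_lambda _ fun i => mY _) lE.aemeasurable hpair
      (indepFun_past_increment hX h k) (indepFun_past_increment hY h k)
    have lDE : HasLaw (fun ω => (D ω, E ω)) ((gaussianReal 0 h).prod (gaussianReal 0 h)) P :=
      IndepFun.hasLaw_prod lD lE (hpair.comp measurable_snd measurable_snd)
    -- Extension by zero lets the sums over ℕ be written as functions of the finite past; only
    -- indices i ≤ k occur, so the default value is never read.
    let ext : (Fin (k + 1) → ℝ) → ℕ → ℝ := fun u i => if hi : i < k + 1 then u ⟨i, hi⟩ else 0
    have hext : ∀ i, Measurable fun u => ext u i := fun i => by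
      by_cases hi : i < k + 1
      · simp only [ext, hi, dif_pos]; fun_prop
      · simp only [ext, hi, dif_neg, not_false_eq_true]; fun_prop
    let F : (Fin (k + 1) → ℝ) × (Fin (k + 1) → ℝ) → HeisenbergSpace := fun z =>
      (ext z.1 k, ext z.2 k,
        (1 / 2) * (∑ i ∈ Finset.range k, ext z.1 i * (ext z.2 (i + 1) - ext z.2 i) -
          ∑ i ∈ Finset.range k, ext z.2 i * (ext z.1 (i + 1) - ext z.1 i)))
    have hF : Measurable F := by
      have h1 : ∀ i, Measurable fun z : (Fin (k + 1) → ℝ) × (Fin (k + 1) → ℝ) => ext z.1 i :=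
        fun i => (hext i).comp measurable_fst
      have h2 : ∀ i, Measurable fun z : (Fin (k + 1) → ℝ) × (Fin (k + 1) → ℝ) => ext z.2 i :=
        fun i => (hext i).comp measurable_snd
      refine (h1 k).prodMk ((h2 k).prodMk (Measurable.const_mul (Measurable.sub ?_ ?_) _))
      · exact Finset.measurable_fun_sum _ fun i _ => (h1 i).mul ((h2 (i + 1)).sub (h2 i))
      · exact Finset.measurable_fun_sum _ fun i _ => (h2 i).mul ((h1 (i + 1)).sub (h1 i))
    have hFe : ∀ ω, F (U ω, V ω) = discretePath X Y h k ω := fun ω => by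
      have e1 : ∀ i, i < k + 1 → ext (U ω) i = X (i * h) ω := fun i hi => by simp only [ext, dif_pos hi, hU]
      have e2 : ∀ i, i < k + 1 → ext (V ω) i = Y (i * h) ω := fun i hi => by simp only [ext, dif_pos hi, hV]
      simp only [F, discretePath]
      rw [e1 k (by omega), e2 k (by omega)]
      congr 4 <;> refine Finset.sum_congr rfl fun i hi => ?_
      · have := Finset.mem_range.1 hi
        rw [e1 i (by omega), e2 i (by omega), e2 (i + 1) (by omega)]
      · have := Finset.mem_range.1 hi
        rw [e2 i (by omega), e1 i (by omega), e1 (i + 1) (by omega)]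
    have hind2 : IndepFun (discretePath X Y h k) (fun ω => (D ω, E ω)) P := by
      have e : (fun ω => F (U ω, V ω)) = discretePath X Y h k := funext hFe
      rw [← e]
      exact hind.comp hF measurable_id
    have hlaw := IndepFun.hasLaw_prod ih lDE hind2
    have hM : Measurable fun z : HeisenbergSpace × (ℝ × ℝ) =>
        heisenbergMul z.1 (z.2.1, z.2.2, 0) := by fun_prop
    refine ⟨?_, ?_⟩
    · have := hM.comp_aemeasurable hlaw.aemeasurable
      refine this.congr (ae_of_all _ fun ω => ?_)
      simp only [Function.comp, discretePath_succ, hD, hE]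
    · have e : discretePath X Y h (k + 1) = (fun z : HeisenbergSpace × (ℝ × ℝ) =>
          heisenbergMul z.1 (z.2.1, z.2.2, 0)) ∘ fun ω => (discretePath X Y h k ω, (D ω, E ω)) := by
        funext ω
        simp only [Function.comp, discretePath_succ, hD, hE]
      have e2 : (gaussianReal 0 h).prod (gaussianReal 0 h) =
          planeGaussian.map (Prod.map (fun x => √(h : ℝ) * x) (fun x => √(h : ℝ) * x)) := by
        rw [planeGaussian, ← Measure.map_prod_map _ _ (by fun_prop) (by fun_prop),
          ← gaussianReal_eq_map_sqrt]
      have e3 : (walkLaw (√(h : ℝ)) k).prod (planeGaussian.map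
          (Prod.map (fun x => √(h : ℝ) * x) (fun x => √(h : ℝ) * x))) =
          ((walkLaw (√(h : ℝ)) k).prod planeGaussian).map
            (Prod.map id (Prod.map (fun x => √(h : ℝ) * x) (fun x => √(h : ℝ) * x))) := by
        rw [← Measure.map_prod_map _ _ measurable_id (by fun_prop), Measure.map_id]
      rw [e, ← AEMeasurable.map_map_of_aemeasurable hM.aemeasurable hlaw.aemeasurable,
        hlaw.map_eq, e2, e3, Measure.map_map hM (by fun_prop), walkLaw_succ']
      rfl

end Brownian

/-! ### Squares of Schwartz functions -/

lemma leftEnergy_eq_of_fderiv {f g : HeisenbergSpace → ℝ} {p : HeisenbergSpace} {c : ℝ}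
    (h : fderiv ℝ g p = c • fderiv ℝ f p) (ν : ℝ) :
    leftEnergy ν g p = c ^ 2 * leftEnergy ν f p := by
  simp only [leftEnergy, partialX, partialY, partialZ, h, _root_.smul_apply,
    smul_eq_mul]
  ring

lemma leftEnergy_nonneg {ν : ℝ} (hν : 0 ≤ ν) (f : HeisenbergSpace → ℝ) (p : HeisenbergSpace) :
    0 ≤ leftEnergy ν f p := by
  unfold leftEnergy
  positivity

lemma norm_sq_le_sum_sq (d : HeisenbergSpace) : ‖d‖ ^ 2 ≤ d.1 ^ 2 + d.2.1 ^ 2 + d.2.2 ^ 2 := by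
  have h : ‖d‖ = max |d.1| (max |d.2.1| |d.2.2|) := rfl
  rw [h]
  rcases max_choice |d.1| (max |d.2.1| |d.2.2|) with h | h <;> rw [h]
  · rw [sq_abs]; nlinarith [sq_nonneg d.2.1, sq_nonneg d.2.2]
  rcases max_choice |d.2.1| |d.2.2| with h | h <;> rw [h, sq_abs]
  · nlinarith [sq_nonneg d.1, sq_nonneg d.2.2]
  · nlinarith [sq_nonneg d.1, sq_nonneg d.2.1]

lemma ContinuousLinearMap.abs_apply_le_of_norm_le {φ : HeisenbergSpace →L[ℝ] ℝ} {M : ℝ}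
    (h : ‖φ‖ ≤ M) {v : HeisenbergSpace} (hv : ‖v‖ ≤ 1) : |φ v| ≤ M :=
  ((φ.le_opNorm v).trans (mul_le_of_le_one_right (norm_nonneg _) hv)).trans h

lemma norm_basis_le : ‖((1, 0, 0) : HeisenbergSpace)‖ ≤ 1 ∧ ‖((0, 1, 0) : HeisenbergSpace)‖ ≤ 1 ∧
    ‖((0, 0, 1) : HeisenbergSpace)‖ ≤ 1 := by
  simp [Prod.norm_def]

lemma SchwartzMap.continuous_fderiv (f : 𝓢(HeisenbergSpace, ℝ)) : Continuous (fderiv ℝ f) :=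
  (f.smooth 1).continuous_fderiv one_ne_zero

/-- The Lipschitz bound on the derivative gives the quadratic Taylor remainder of f². The bound on
‖p‖ ‖f'(p)‖ controls the linearly growing coefficients of the left-invariant fields. -/
lemma SchwartzMap.exists_norm_fderiv_le (f : 𝓢(HeisenbergSpace, ℝ)) :
    ∃ M, 0 ≤ M ∧ (∀ p, |f p| ≤ M) ∧ (∀ p, ‖fderiv ℝ f p‖ ≤ M) ∧
      (∀ p, ‖p‖ * ‖fderiv ℝ f p‖ ≤ M) ∧
      ∀ p q, ‖fderiv ℝ f q - fderiv ℝ f p‖ ≤ M * ‖q - p‖ := by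
  set f' := SchwartzMap.fderivCLM ℝ HeisenbergSpace ℝ f
  have e : (f' : HeisenbergSpace → _) = fderiv ℝ f := rfl
  set f'' := SchwartzMap.fderivCLM ℝ HeisenbergSpace _ f'
  set M0 := SchwartzMap.seminorm ℝ 0 0 f
  set M1 := SchwartzMap.seminorm ℝ 0 0 f'
  set M2 := SchwartzMap.seminorm ℝ 1 0 f'
  set M3 := SchwartzMap.seminorm ℝ 0 0 f''
  have h0 : 0 ≤ M0 := apply_nonneg _ _
  have h1 : 0 ≤ M1 := apply_nonneg _ _
  have h2 : 0 ≤ M2 := apply_nonneg _ _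
  have h3 : 0 ≤ M3 := apply_nonneg _ _
  refine ⟨M0 + M1 + M2 + M3, by positivity, fun p => ?_, fun p => ?_, fun p => ?_, fun p q => ?_⟩
  · have := SchwartzMap.norm_le_seminorm ℝ f p
    rw [Real.norm_eq_abs] at this
    linarith
  · have := SchwartzMap.norm_le_seminorm ℝ f' p
    rw [e] at this
    linarith
  · have := SchwartzMap.norm_pow_mul_le_seminorm ℝ f' 1 p
    rw [e, pow_one] at this
    linarith
  · have := (convex_univ).norm_image_sub_le_of_norm_fderiv_le (𝕜 := ℝ) (f := f') (C := M3)
      (fun x _ => f'.differentiableAt) (fun x _ => SchwartzMap.norm_le_seminorm ℝ f'' x)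
      (Set.mem_univ p) (Set.mem_univ q)
    rw [e] at this
    refine this.trans ?_
    gcongr
    linarith

lemma SchwartzMap.hasFDerivAt_sq_add (f : 𝓢(HeisenbergSpace, ℝ)) (ε : ℝ) (p : HeisenbergSpace) :
    HasFDerivAt (fun p => f p ^ 2 + ε) ((2 * f p) • fderiv ℝ f p) p := by
  have := ((f.differentiableAt (x := p)).hasFDerivAt.pow 2).add_const ε
  simpa using this

lemma SchwartzMap.isUniformlyRegular_sq_add (f : 𝓢(HeisenbergSpace, ℝ)) {ε : ℝ} (hε : 0 < ε) :
    ∃ K, IsUniformlyRegular (fun p => f p ^ 2 + ε) ε K := by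
  obtain ⟨M, hM, hf, hf', -, hL⟩ := f.exists_norm_fderiv_le
  have hd := f.hasFDerivAt_sq_add ε
  have hfd : ∀ p, fderiv ℝ (fun p => f p ^ 2 + ε) p = (2 * f p) • fderiv ℝ f p :=
    fun p => (hd p).fderiv
  have hcont : Continuous (fderiv ℝ fun p => f p ^ 2 + ε) := by
    rw [funext hfd]
    exact (continuous_const.mul f.continuous).smul f.continuous_fderiv
  have hb : ∀ p, ‖fderiv ℝ (fun p => f p ^ 2 + ε) p‖ ≤ 4 * M ^ 2 + ε := fun p => by
    rw [hfd, norm_smul, norm_mul, Real.norm_eq_abs, Real.norm_eq_abs, abs_two]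
    have := mul_le_mul (hf p) (hf' p) (norm_nonneg _) hM
    nlinarith
  refine ⟨4 * M ^ 2 + ε, hε, fun p => ?_, fun p => ?_, fun p => (hd p).differentiableAt,
    hcont.clm_apply continuous_const, hcont.clm_apply continuous_const,
    hcont.clm_apply continuous_const,
    fun p => ContinuousLinearMap.abs_apply_le_of_norm_le (hb p) norm_basis_le.1,
    fun p => ContinuousLinearMap.abs_apply_le_of_norm_le (hb p) norm_basis_le.2.1,
    fun p => ContinuousLinearMap.abs_apply_le_of_norm_le (hb p) norm_basis_le.2.2, fun p d => ?_⟩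
  · have := sq_nonneg (f p)
    linarith
  · have := sq_le_sq' (abs_le.1 (hf p)).1 (abs_le.1 (hf p)).2
    nlinarith
  · rw [← fderiv_apply_eq_partials]
    have hlip : ∀ q, ‖(2 * f q) • fderiv ℝ f q - (2 * f p) • fderiv ℝ f p‖ ≤
        4 * M ^ 2 * ‖q - p‖ := fun q => by
      have hfl : |f q - f p| ≤ M * ‖q - p‖ :=
        convex_univ.norm_image_sub_le_of_norm_fderiv_le (𝕜 := ℝ)
          (fun x _ => f.differentiableAt) (fun x _ => hf' x) (Set.mem_univ p) (Set.mem_univ q)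
      have e : (2 * f q) • fderiv ℝ f q - (2 * f p) • fderiv ℝ f p =
          (2 * (f q - f p)) • fderiv ℝ f q + (2 * f p) • (fderiv ℝ f q - fderiv ℝ f p) := by
        module
      rw [e]
      refine (norm_add_le _ _).trans ?_
      rw [norm_smul, norm_smul, norm_mul, norm_mul, Real.norm_eq_abs, Real.norm_eq_abs,
        Real.norm_eq_abs, abs_two]
      have h1 := mul_le_mul hfl (hf' q) (norm_nonneg _) (by positivity)
      have h2 := mul_le_mul (hf p) (hL p q) (norm_nonneg _) hM
      nlinarith
    -- On the ball of radius ‖d‖ the derivative of f² + ε differs from its value at p by at most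
    -- 4M²‖d‖; the mean value inequality then yields the remainder 4M²‖d‖².
    have ht := (convex_closedBall p ‖d‖).norm_image_sub_le_of_norm_hasFDerivWithin_le'
      (f := fun p => f p ^ 2 + ε) (φ := (2 * f p) • fderiv ℝ f p) (C := 4 * M ^ 2 * ‖d‖)
      (fun q _ => (hd q).hasFDerivWithinAt) (fun q hq => (hlip q).trans (by
        have : ‖q - p‖ ≤ ‖d‖ := by rwa [mem_closedBall_iff_norm] at hq
        gcongr))
      (Metric.mem_closedBall_self (norm_nonneg d)) (y := p + d) (by simp)
    rw [add_sub_cancel_left, Real.norm_eq_abs, ← hfd] at ht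
    refine ht.trans ?_
    have := norm_sq_le_sum_sq d
    have h4 : 0 ≤ d.1 ^ 2 + d.2.1 ^ 2 + d.2.2 ^ 2 := by positivity
    calc 4 * M ^ 2 * ‖d‖ * ‖d‖ = 4 * M ^ 2 * ‖d‖ ^ 2 := by ring
      _ ≤ 4 * M ^ 2 * (d.1 ^ 2 + d.2.1 ^ 2 + d.2.2 ^ 2) := by gcongr
      _ ≤ _ := by gcongr; linarith

lemma SchwartzMap.continuous_leftEnergy (f : 𝓢(HeisenbergSpace, ℝ)) (ν : ℝ) :
    Continuous (leftEnergy ν f) := by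
  have hX : Continuous (partialX f) := f.continuous_fderiv.clm_apply continuous_const
  have hY : Continuous (partialY f) := f.continuous_fderiv.clm_apply continuous_const
  have hZ : Continuous (partialZ f) := f.continuous_fderiv.clm_apply continuous_const
  unfold leftEnergy
  fun_prop

lemma SchwartzMap.exists_abs_leftEnergy_le (f : 𝓢(HeisenbergSpace, ℝ)) {ν : ℝ} (hν : 0 ≤ ν) :
    ∃ C, ∀ p, |leftEnergy ν f p| ≤ C := by
  obtain ⟨M, hM, -, hf', hw, -⟩ := f.exists_norm_fderiv_le
  refine ⟨(M + M) ^ 2 + (M + M) ^ 2 + ν * M ^ 2, fun p => ?_⟩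
  have hX : |partialX f p| ≤ M :=
    ContinuousLinearMap.abs_apply_le_of_norm_le (hf' p) norm_basis_le.1
  have hY : |partialY f p| ≤ M :=
    ContinuousLinearMap.abs_apply_le_of_norm_le (hf' p) norm_basis_le.2.1
  have hZ : |partialZ f p| ≤ M :=
    ContinuousLinearMap.abs_apply_le_of_norm_le (hf' p) norm_basis_le.2.2
  have hZ' : |partialZ f p| ≤ ‖fderiv ℝ f p‖ :=
    ContinuousLinearMap.abs_apply_le_of_norm_le le_rfl norm_basis_le.2.2
  have hx : |p.1| ≤ ‖p‖ := norm_fst_le p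
  have hy : |p.2.1| ≤ ‖p‖ := (norm_fst_le p.2).trans (norm_snd_le p)
  have hxZ : |p.1 / 2 * partialZ f p| ≤ M := by
    have := (mul_le_mul hx hZ' (abs_nonneg _) (norm_nonneg _)).trans (hw p)
    rw [abs_mul, abs_div, abs_two]
    linarith [mul_nonneg (abs_nonneg p.1) (abs_nonneg (partialZ f p))]
  have hyZ : |p.2.1 / 2 * partialZ f p| ≤ M := by
    have := (mul_le_mul hy hZ' (abs_nonneg _) (norm_nonneg _)).trans (hw p)
    rw [abs_mul, abs_div, abs_two]
    linarith [mul_nonneg (abs_nonneg p.2.1) (abs_nonneg (partialZ f p))]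
  rw [abs_of_nonneg (leftEnergy_nonneg hν _ _)]
  unfold leftEnergy
  rw [← sq_abs (partialX f p - _), ← sq_abs (partialY f p + _), ← sq_abs (partialZ f p)]
  have h1 := (abs_sub (partialX f p) (p.2.1 / 2 * partialZ f p)).trans (add_le_add hX hyZ)
  have h2 := (abs_add_le (partialY f p) (p.1 / 2 * partialZ f p)).trans (add_le_add hY hxZ)
  gcongr

/-! ### Passage to the limit -/

/-- Along the subsequence `ns`, the laws of the horizontal random walks with step `(n + 1)^{-1/2}`
after `n + 1` and after `n` steps converge weakly to `γ`. -/
structure IsWalkLimit (γ : Measure HeisenbergSpace) (ns : ℕ → ℕ) : Prop where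
  tendsto_index : Tendsto ns atTop atTop
  tendsto_succ : ∀ φ : HeisenbergSpace → ℝ, Continuous φ → ∀ C, (∀ p, |φ p| ≤ C) →
    Tendsto (fun i => ∫ p, φ p ∂walkLaw (√((ns i + 1 : ℝ)⁻¹)) (ns i + 1)) atTop (nhds (∫ p, φ p ∂γ))
  tendsto_self : ∀ φ : HeisenbergSpace → ℝ, Continuous φ → ∀ C, (∀ p, |φ p| ≤ C) →
    Tendsto (fun i => ∫ p, φ p ∂walkLaw (√((ns i + 1 : ℝ)⁻¹)) (ns i)) atTop (nhds (∫ p, φ p ∂γ))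

/-- All the walks are realised on one probability space, so almost sure convergence and dominated
convergence give weak convergence of the laws. -/
lemma tendsto_integral_of_hasLaw {Ω : Type*} [MeasurableSpace Ω] {P : Measure Ω}
    [IsProbabilityMeasure P] {D : ℕ → Ω → HeisenbergSpace} {Z : Ω → HeisenbergSpace}
    {μ : ℕ → Measure HeisenbergSpace} {γ : Measure HeisenbergSpace} (hD : ∀ n, HasLaw (D n) (μ n) P)
    (hZ : HasLaw Z γ P) (h : ∀ᵐ ω ∂P, Tendsto (fun n => D n ω) atTop (nhds (Z ω)))
    {φ : HeisenbergSpace → ℝ} (hφ : Continuous φ) {C : ℝ} (hC : ∀ p, |φ p| ≤ C) :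
    Tendsto (fun n => ∫ p, φ p ∂μ n) atTop (nhds (∫ p, φ p ∂γ)) := by
  have e : ∀ n, ∫ p, φ p ∂μ n = ∫ ω, φ (D n ω) ∂P := fun n =>
    ((hD n).integral_comp hφ.aestronglyMeasurable).symm
  rw [← hZ.integral_comp hφ.aestronglyMeasurable]
  simp_rw [e]
  refine tendsto_integral_of_dominated_convergence (fun _ => C)
    (fun n => hφ.aestronglyMeasurable.comp_aemeasurable (hD n).aemeasurable)
    (integrable_const C) (fun n => ae_of_all _ fun ω => hC _) ?_
  filter_upwards [h] with ω hω
  exact (hφ.tendsto _).comp hω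

lemma discretePath_eq_riemannSum {Ω : Type*} (X Y : ℝ≥0 → Ω → ℝ) (n : ℕ) (ω : Ω) :
    discretePath X Y ((n + 1 : ℕ) : ℝ≥0)⁻¹ (n + 1) ω = (X 1 ω, Y 1 ω, (1 / 2) *
      ((∑ k ∈ Finset.range (n + 1), X ((k : ℝ≥0) * 1 / ((n + 1 : ℕ) : ℝ≥0)) ω *
        (Y (((k : ℝ≥0) + 1) * 1 / ((n + 1 : ℕ) : ℝ≥0)) ω -
          Y ((k : ℝ≥0) * 1 / ((n + 1 : ℕ) : ℝ≥0)) ω)) -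
      (∑ k ∈ Finset.range (n + 1), Y ((k : ℝ≥0) * 1 / ((n + 1 : ℕ) : ℝ≥0)) ω *
        (X (((k : ℝ≥0) + 1) * 1 / ((n + 1 : ℕ) : ℝ≥0)) ω -
          X ((k : ℝ≥0) * 1 / ((n + 1 : ℕ) : ℝ≥0)) ω)))) := by
  have h1 : ((n + 1 : ℕ) : ℝ≥0) * ((n + 1 : ℕ) : ℝ≥0)⁻¹ = 1 :=
    mul_inv_cancel₀ (by exact_mod_cast n.succ_ne_zero)
  simp only [discretePath, h1]
  simp only [mul_one, div_eq_mul_inv, Nat.cast_add, Nat.cast_one]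

lemma discretePath_eq_mul {Ω : Type*} (X Y : ℝ≥0 → Ω → ℝ) (h : ℝ≥0) (n : ℕ) (ω : Ω) :
    discretePath X Y h n ω = heisenbergMul (discretePath X Y h (n + 1) ω)
      (-(X ((n + 1 : ℕ) * h) ω - X (n * h) ω), -(Y ((n + 1 : ℕ) * h) ω - Y (n * h) ω), 0) := by
  rw [discretePath_succ]
  ext <;> simp only [heisenbergMul] <;> ring

lemma tendsto_mul_succ_inv : Tendsto (fun n : ℕ => (n : ℝ≥0) * ((n + 1 : ℕ) : ℝ≥0)⁻¹) atTop
    (nhds 1) := by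
  rw [← NNReal.tendsto_coe]
  have := tendsto_natCast_div_add_atTop (1 : ℝ)
  simpa [div_eq_mul_inv] using this

lemma IsHeisenbergHeatProcess.exists_isWalkLimit {Ω : Type*} [MeasurableSpace Ω] {P : Measure Ω}
    [IsProbabilityMeasure P] {H : ℝ≥0 → Ω → HeisenbergSpace} (hH : IsHeisenbergHeatProcess P 0 H)
    {γ : Measure HeisenbergSpace} (hγ : HasLaw (H 1) γ P) : ∃ ns, IsWalkLimit γ ns := by
  obtain ⟨X, Y, A, hX, hY, hXY, ⟨-, hA⟩, hH⟩ := hH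
  obtain ⟨I, J, hI, hJ, hA⟩ := hA 1
  -- Convergence in probability gives almost sure convergence along a subsequence, extracted first
  -- for one Itô integral and then again for the other. The index is shifted by one so that the mesh
  -- 1/(n+1) is never degenerate.
  obtain ⟨n₁, hn₁, h₁⟩ := (TendstoInMeasure.comp hI (tendsto_add_atTop_nat 1)).exists_seq_tendsto_ae
  obtain ⟨n₂, hn₂, h₂⟩ := (TendstoInMeasure.comp hJ
    ((tendsto_add_atTop_nat 1).comp hn₁.tendsto_atTop)).exists_seq_tendsto_ae
  have hns : Tendsto (fun i => n₁ (n₂ i)) atTop atTop := hn₁.tendsto_atTop.comp hn₂.tendsto_atTop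
  set ns : ℕ → ℕ := fun i => n₁ (n₂ i) with hnsdef
  have hlaw : ∀ n k, HasLaw (discretePath X Y ((n + 1 : ℕ) : ℝ≥0)⁻¹ k)
      (walkLaw (√((n + 1 : ℝ)⁻¹)) k) P := fun n k => by
    have := hasLaw_discretePath hX.toIsPreBrownianReal hY.toIsPreBrownianReal hXY
      ((n + 1 : ℕ) : ℝ≥0)⁻¹ k
    simpa using this
  have hsucc : ∀ᵐ ω ∂P, Tendsto
      (fun i => discretePath X Y ((ns i + 1 : ℕ) : ℝ≥0)⁻¹ (ns i + 1) ω) atTop (nhds (H 1 ω)) := by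
    filter_upwards [h₁, h₂, hA] with ω h₁ h₂ hA
    rw [hH, zero_heisenbergMul, hA]
    simp_rw [discretePath_eq_riemannSum]
    exact tendsto_const_nhds.prodMk_nhds (tendsto_const_nhds.prodMk_nhds
      (((h₁.comp hn₂.tendsto_atTop).sub h₂).const_mul _))
  -- The path after n steps is the path after n + 1 steps multiplied by the inverse of the last
  -- increment, which tends to the identity by continuity of X and Y at time 1.
  have hself : ∀ᵐ ω ∂P, Tendsto
      (fun i => discretePath X Y ((ns i + 1 : ℕ) : ℝ≥0)⁻¹ (ns i) ω) atTop (nhds (H 1 ω)) := by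
    filter_upwards [hsucc, hX.cont, hY.cont] with ω h hXc hYc
    have hinc : ∀ Z : ℝ≥0 → Ω → ℝ, Continuous (fun t => Z t ω) → Tendsto (fun i =>
        -(Z ((ns i + 1 : ℕ) * ((ns i + 1 : ℕ) : ℝ≥0)⁻¹) ω -
          Z (ns i * ((ns i + 1 : ℕ) : ℝ≥0)⁻¹) ω)) atTop (nhds 0) := fun Z hZ => by
      have h1 : ∀ n : ℕ, ((n + 1 : ℕ) : ℝ≥0) * ((n + 1 : ℕ) : ℝ≥0)⁻¹ = 1 := fun n =>
        mul_inv_cancel₀ (by exact_mod_cast n.succ_ne_zero)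
      simp_rw [h1]
      have := ((hZ.tendsto 1).comp (tendsto_mul_succ_inv.comp hns)).const_sub (Z 1 ω) |>.neg
      rwa [sub_self, neg_zero] at this
    have h2 := h.prodMk_nhds ((hinc X hXc).prodMk_nhds ((hinc Y hYc).prodMk_nhds
      (tendsto_const_nhds (x := (0 : ℝ)))))
    have h3 := (continuous_heisenbergMul.tendsto _).comp h2
    have e : heisenbergMul (H 1 ω) ((0 : ℝ), (0 : ℝ), (0 : ℝ)) = H 1 ω := heisenbergMul_zero _
    simp only [e] at h3
    refine h3.congr fun i => ?_
    exact (discretePath_eq_mul X Y _ _ ω).symm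
  exact ⟨ns, hns,
    fun φ hφ C hC => tendsto_integral_of_hasLaw (fun i => hlaw _ _) hγ hsucc hφ hC,
    fun φ hφ C hC => tendsto_integral_of_hasLaw (fun i => hlaw _ _) hγ hself hφ hC⟩

namespace IsWalkLimit

variable {γ : Measure HeisenbergSpace} {ns : ℕ → ℕ}

lemma integral_comp_neg (h : IsWalkLimit γ ns) {φ : HeisenbergSpace → ℝ} (hφ : Continuous φ) {C : ℝ}
    (hC : ∀ p, |φ p| ≤ C) : ∫ p, φ (-p) ∂γ = ∫ p, φ p ∂γ := by
  refine tendsto_nhds_unique (h.tendsto_self _ (hφ.comp continuous_neg) C fun p => hC _) ?_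
  refine (h.tendsto_self φ hφ C hC).congr fun i => ?_
  conv_lhs => rw [← map_neg_walkLaw]
  rw [integral_map (by fun_prop) hφ.aestronglyMeasurable]

/-- The shift by ε supplies the positive lower bound required by the walk estimates. Every integrand
in the limit is continuous and bounded, so weak convergence suffices. -/
lemma entropy_sq_add_le (h : IsWalkLimit γ ns) {ν : ℝ} (hν : 0 < ν) (f : 𝓢(HeisenbergSpace, ℝ))
    {ε : ℝ} (hε : 0 < ε) : entropy γ (fun p => f p ^ 2 + ε) ≤
      2 * ν * (Real.exp (1 / ν) - 1) * ∫ p, leftEnergy ν f p ∂γ := by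
  obtain ⟨K, hg⟩ := f.isUniformlyRegular_sq_add hε
  obtain ⟨M, hM⟩ := f.exists_abs_leftEnergy_le hν.le
  obtain ⟨C, hC⟩ := hg.entropy_walkLaw_le hν
  have hcg : Continuous fun p => f p ^ 2 + ε := by fun_prop
  have hψ : Continuous fun p => (f p ^ 2 + ε) * Real.log (f p ^ 2 + ε) :=
    Real.continuous_mul_log.comp hcg
  obtain ⟨D, hD⟩ := (isCompact_Icc (a := ε) (b := K)).exists_bound_of_continuousOn
    Real.continuous_mul_log.continuousOn
  have t1 := h.tendsto_succ _ hψ D fun p => hD _ ⟨hg.lower p, hg.upper p⟩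
  have t2 := h.tendsto_succ _ hcg K fun p => hg.abs_le p
  have t3 := h.tendsto_self _ (f.continuous_leftEnergy ν) M hM
  have ht0 : Tendsto (fun i => √((ns i + 1 : ℝ)⁻¹)) atTop (nhds 0) := by
    have : Tendsto (fun n : ℕ => √((n + 1 : ℝ)⁻¹)) atTop (nhds √0) := by
      refine (Real.continuous_sqrt.tendsto 0).comp ?_
      simpa using tendsto_one_div_add_atTop_nhds_zero_nat (𝕜 := ℝ)
    rw [Real.sqrt_zero] at this
    exact this.comp h.tendsto_index
  have hent := t1.sub ((Real.continuous_mul_log.tendsto _).comp t2)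
  have hrhs := (t3.const_mul (2 * ν * (Real.exp (1 / ν) - 1))).add (ht0.const_mul C)
  rw [mul_zero, add_zero] at hrhs
  refine le_of_tendsto_of_tendsto' hent hrhs fun i => ?_
  set t := √((ns i + 1 : ℝ)⁻¹) with ht
  have hpos : (0 : ℝ) < ns i + 1 := by positivity
  have ht2 : (ns i + 1 : ℝ) * t ^ 2 = 1 := by
    rw [ht, Real.sq_sqrt (by positivity), mul_inv_cancel₀ hpos.ne']
  refine (hC (by positivity) ht2).trans ?_
  have hexp : 0 ≤ Real.exp (1 / ν) - 1 := by
    have := Real.add_one_le_exp (1 / ν)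
    have : 0 < 1 / ν := by positivity
    linarith
  -- The chain rule gives Γ(f² + ε) = 4f² Γ(f), and f²/(f² + ε) ≤ 1. The bound is free of ε.
  have hle : ∫ p, leftEnergy ν (fun p => f p ^ 2 + ε) p / (f p ^ 2 + ε) ∂walkLaw t (ns i) ≤
      ∫ p, 4 * leftEnergy ν f p ∂walkLaw t (ns i) := by
    have hi : Integrable (leftEnergy ν f) (walkLaw t (ns i)) :=
      Integrable.of_bound (f.continuous_leftEnergy ν).aestronglyMeasurable M (ae_of_all _ hM)
    refine integral_mono_of_nonneg (ae_of_all _ fun p => ?_) (hi.const_mul 4)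
      (ae_of_all _ fun p => ?_)
    · exact div_nonneg (leftEnergy_nonneg hν.le _ _) (by positivity)
    · have h0 := leftEnergy_nonneg hν.le f p
      beta_reduce
      rw [leftEnergy_eq_of_fderiv (f.hasFDerivAt_sq_add ε p).fderiv,
        div_le_iff₀ (by positivity)]
      nlinarith [mul_nonneg h0 hε.le]
  rw [integral_const_mul] at hle
  have := mul_le_mul_of_nonneg_left hle (by positivity : 0 ≤ ν / 2 * (Real.exp (1 / ν) - 1))
  linarith

/-- The right side does not depend on ε, and u log u is continuous up to 0, so ε → 0 is dominated
convergence. -/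
lemma entropy_sq_le [IsProbabilityMeasure γ] (h : IsWalkLimit γ ns) {ν : ℝ} (hν : 0 < ν)
    (f : 𝓢(HeisenbergSpace, ℝ)) : entropy γ (fun p => f p ^ 2) ≤
      2 * ν * (Real.exp (1 / ν) - 1) * ∫ p, leftEnergy ν f p ∂γ := by
  obtain ⟨M, hM, hf, -⟩ := f.exists_norm_fderiv_le
  set ε : ℕ → ℝ := fun k => 1 / (k + 1 : ℝ) with hεdef
  have hε0 : ∀ k, 0 < ε k := fun k => by positivity
  have hε1 : ∀ k, ε k ≤ 1 := fun k => by
    rw [hεdef]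
    exact div_le_one_of_le₀ (by linarith [(Nat.cast_nonneg k : (0 : ℝ) ≤ k)]) (by positivity)
  have hε : Tendsto ε atTop (nhds 0) := tendsto_one_div_add_atTop_nhds_zero_nat
  have hmem : ∀ k p, f p ^ 2 + ε k ∈ Set.Icc 0 (M ^ 2 + 1) := fun k p => by
    have := sq_le_sq' (abs_le.1 (hf p)).1 (abs_le.1 (hf p)).2
    exact ⟨add_nonneg (sq_nonneg _) (hε0 k).le, add_le_add this (hε1 k)⟩
  have hlim : ∀ p, Tendsto (fun k => f p ^ 2 + ε k) atTop (nhds (f p ^ 2)) := fun p => by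
    simpa using hε.const_add (f p ^ 2)
  obtain ⟨D, hD⟩ := (isCompact_Icc (a := (0 : ℝ)) (b := M ^ 2 + 1)).exists_bound_of_continuousOn
    Real.continuous_mul_log.continuousOn
  have hcont : ∀ k, Continuous fun p => f p ^ 2 + ε k := fun k => by fun_prop
  have t1 := tendsto_integral_of_dominated_convergence (μ := γ)
    (F := fun k p => (f p ^ 2 + ε k) * Real.log (f p ^ 2 + ε k))
    (f := fun p => f p ^ 2 * Real.log (f p ^ 2)) (fun _ => D)
    (fun k => (Real.continuous_mul_log.comp (hcont k)).aestronglyMeasurable) (integrable_const D)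
    (fun k => ae_of_all _ fun p => hD _ (hmem k p))
    (ae_of_all _ fun p => (Real.continuous_mul_log.tendsto _).comp (hlim p))
  have t2 := tendsto_integral_of_dominated_convergence (μ := γ)
    (F := fun k p => f p ^ 2 + ε k) (f := fun p => f p ^ 2) (fun _ => M ^ 2 + 1)
    (fun k => (hcont k).aestronglyMeasurable) (integrable_const _)
    (fun k => ae_of_all _ fun p => by
      rw [Real.norm_eq_abs, abs_of_nonneg (hmem k p).1]
      exact (hmem k p).2)
    (ae_of_all _ hlim)
  exact le_of_tendsto' (t1.sub ((Real.continuous_mul_log.tendsto _).comp t2)) fun k =>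
    h.entropy_sq_add_le hν f (hε0 k)

end IsWalkLimit

/-! ### Symmetrization under inversion. -/

lemma fderiv_comp_neg_apply {f : HeisenbergSpace → ℝ} (hf : Differentiable ℝ f)
    (p v : HeisenbergSpace) : fderiv ℝ (fun q => f (-q)) p v = -fderiv ℝ f (-p) v := by
  have := (hf (-p)).hasFDerivAt.comp p (hasFDerivAt_id p).neg
  rw [show (fun q => f (-q)) = f ∘ Neg.neg from rfl, this.fderiv]
  simp

theorem mainTheorem4 {Ω : Type*} [MeasurableSpace Ω] (P : Measure Ω) [IsProbabilityMeasure P]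
    (H : ℝ≥0 → Ω → HeisenbergSpace) (hH : IsHeisenbergHeatProcess P 0 H)
    (γ : Measure HeisenbergSpace) (hγ : HasLaw (H 1) γ P)
    (ν : ℝ) (hν : 0 < ν) (f : 𝓢(HeisenbergSpace, ℝ)) :
    entropy γ (fun p => f p ^ 2) ≤
      2 * ν * (Real.exp (1 / ν) - 1) *
        ∫ p, (partialX f p ^ 2 + partialY f p ^ 2 +
          (ν + (p.1 ^ 2 + p.2.1 ^ 2) / 4) * partialZ f p ^ 2) ∂γ := by
  have hprob : IsProbabilityMeasure γ := hγ.isProbabilityMeasure_iff.1 inferInstance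
  obtain ⟨ns, h⟩ := hH.exists_isWalkLimit hγ
  -- The function f(-p) has the same entropy under γ, and its left-invariant energy at -p is the
  -- right-invariant energy of f at p.
  set f' : 𝓢(HeisenbergSpace, ℝ) :=
    SchwartzMap.compCLMOfContinuousLinearEquiv ℝ (ContinuousLinearEquiv.neg ℝ) f with hf'
  have e : (f' : HeisenbergSpace → ℝ) = fun p => f (-p) := rfl
  obtain ⟨M, -, hM, -⟩ := f.exists_norm_fderiv_le
  obtain ⟨D, hD⟩ := (isCompact_Icc (a := (0 : ℝ)) (b := M ^ 2)).exists_bound_of_continuousOn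
    Real.continuous_mul_log.continuousOn
  have hmem : ∀ p, f p ^ 2 ∈ Set.Icc 0 (M ^ 2) := fun p =>
    ⟨sq_nonneg _, sq_le_sq' (abs_le.1 (hM p)).1 (abs_le.1 (hM p)).2⟩
  have hc : Continuous fun p => f p ^ 2 := by fun_prop
  have hent : entropy γ (fun p => f' p ^ 2) = entropy γ fun p => f p ^ 2 := by
    have h1 := h.integral_comp_neg hc (C := M ^ 2) fun p => by
      rw [abs_of_nonneg (hmem p).1]
      exact (hmem p).2
    have h2 := h.integral_comp_neg (Real.continuous_mul_log.comp hc) (C := D) fun p => hD _ (hmem p)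
    simp only [Function.comp] at h2
    simp only [entropy, e, h1, h2]
  obtain ⟨C, hC⟩ := f.exists_abs_leftEnergy_le hν.le
  obtain ⟨C', hC'⟩ := f'.exists_abs_leftEnergy_le hν.le
  have hleft := h.entropy_sq_le hν f
  have hright := h.entropy_sq_le hν f'
  rw [hent, ← h.integral_comp_neg (f'.continuous_leftEnergy ν) hC'] at hright
  have i1 : Integrable (leftEnergy ν f) γ :=
    Integrable.of_bound (f.continuous_leftEnergy ν).aestronglyMeasurable C (ae_of_all _ hC)
  have i2 : Integrable (fun p => leftEnergy ν f' (-p)) γ :=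
    Integrable.of_bound ((f'.continuous_leftEnergy ν).comp continuous_neg).aestronglyMeasurable C'
      (ae_of_all _ fun p => hC' _)
  -- The left and right fields are ∂ₓ ∓ (y/2)∂_z and ∂_y ± (x/2)∂_z. In the mean of the squares the
  -- mixed terms cancel, leaving (x² + y²)/4 in front of (∂_z f)².
  have hsum : ∫ p, (partialX f p ^ 2 + partialY f p ^ 2 +
      (ν + (p.1 ^ 2 + p.2.1 ^ 2) / 4) * partialZ f p ^ 2) ∂γ =
      (1 / 2) * (∫ p, leftEnergy ν f p ∂γ + ∫ p, leftEnergy ν f' (-p) ∂γ) := by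
    rw [← integral_add i1 i2, ← integral_const_mul]
    refine integral_congr_ae (ae_of_all _ fun p => ?_)
    simp only [leftEnergy, partialX, partialY, partialZ, e, fderiv_comp_neg_apply f.differentiable, neg_neg,
      Prod.fst_neg, Prod.snd_neg]
    ring
  rw [hsum]
  linarith
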